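/- Let $\mathbb{F}$ be a field of characteristic $0$, and let $\mathcal{T}$ be the free symmetric operad over $\mathbb{F}$ generated by one binary operation $(a_1,a_2)\mapsto a_1a_2$ without symmetries; its component $\mathcal{T}(n)$ has as a basis the multilinear nonassociative monomials in $a_1,\dots,a_n$, on which $S_n$ acts by permuting the arguments. For $\mathbf{x}=(x_1,\dots,x_6)\in\mathbb{F}^6$, let $\mathcal{O}_{\mathbf{x}}=\mathcal{T}/\mathcal{J}_{\mathbf{x}}$, where $\mathcal{J}_{\mathbf{x}}$ is the operad ideal (a family of $S_n$-submodules of the $\mathcal{T}(n)$, closed under composition on both sides with elements of $\mathcal{T}$) generated by the relation $$(a_1a_2)a_3 = x_1\,a_1(a_2a_3)+x_2\,a_1(a_3a_2)+x_3\,a_2(a_1a_3)+x_4\,a_2(a_3a_1)+x_5\,a_3(a_1a_2)+x_6\,a_3(a_2a_1). \qquad \text{(LR)}$$ Call $\mathbf{x}$ regular if for every $n\ge 1$ the $S_n$-module $\mathcal{O}_{\mathbf{x}}(n)$ is isomorphic to the regular module $\mathbb{F}S_n$. Suppose that $x_5=x_6=0$. Then $\mathbf{x}$ is regular if and only if $(x_1,x_2,x_3,x_4)$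 is one of $$(0,0,0,0),\qquad (1,0,0,0),\qquad (1,1,0,0),\qquad (1,0,-1,0).$$ For these four points, (LR) is respectively the left-nilpotent identity $(a_1a_2)a_3=0$, associativity $(a_1a_2)a_3=a_1(a_2a_3)$, the (right) Zinbiel identity $(a_1a_2)a_3=a_1(a_2a_3)+a_1(a_3a_2)$, and the (left) Leibniz identity $(a_1a_2)a_3=a_1(a_2a_3)-a_2(a_1a_3)$. -/

import Mathlib

noncomputable section

namespace LROperad

/-! ### Multilinear nonassociative monomials -/

/-- The multiset of letters (with multiplicity) occurring in a nonassociative word. -/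
def letters {α : Type*} : FreeMagma α → Multiset α
  | .of a => {a}
  | .mul u v => letters u + letters v

/-- A bracketed word in `a₁, …, aₙ` (letters indexed by `Fin n`) in which every letter occurs
exactly once. -/
def IsMultilinear {n : ℕ} (w : FreeMagma (Fin n)) : Prop :=
  letters w = Finset.univ.val

/-- Multilinear nonassociative monomials of arity `n`: all bracketings of all orderings of
`a₁, …, aₙ`. -/
abbrev Monomial (n : ℕ) : Type := {w : FreeMagma (Fin n) // IsMultilinear w}

theorem letters_lift {α β : Type*} (f : α → FreeMagma β) (w : FreeMagma α) :
    letters (FreeMagma.lift f w) = (letters w).bind fun a => letters (f a) := by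
  induction w with
  | ih1 a => simp [letters]
  | ih2 u v hu hv =>
    rw [map_mul]
    change letters (FreeMagma.lift f u) + letters (FreeMagma.lift f v) =
      (letters u + letters v).bind _
    rw [hu, hv, Multiset.add_bind]

theorem letters_map {α β : Type*} (f : α → β) (w : FreeMagma α) :
    letters (FreeMagma.map f w) = (letters w).map f := by
  rw [FreeMagma.map, letters_lift]
  exact Multiset.bind_singleton _ f

/-- Renaming the letters of a multilinear monomial by a permutation: `aᵢ ↦ a_{σ(i)}`. -/
def Monomial.relabel {n : ℕ} (σ : Equiv.Perm (Fin n)) (w : Monomial n) : Monomial n :=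
  ⟨FreeMagma.map σ w.1, by
    have h : letters w.1 = Finset.univ.val := w.2
    rw [IsMultilinear, letters_map, h, ← Equiv.coe_toEmbedding, ← Finset.map_val,
      Finset.map_univ_equiv]⟩

theorem Monomial.relabel_one {n : ℕ} (w : Monomial n) : w.relabel 1 = w :=
  Subtype.ext <| by
    change FreeMagma.map id w.1 = w.1
    induction w.1 with
    | ih1 a => rfl
    | ih2 u v hu hv => rw [map_mul, hu, hv]

theorem Monomial.relabel_mul {n : ℕ} (σ τ : Equiv.Perm (Fin n)) (w : Monomial n) :
    w.relabel (σ * τ) = (w.relabel τ).relabel σ :=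
  Subtype.ext <| by
    change FreeMagma.map (σ * τ) w.1 = FreeMagma.map σ (FreeMagma.map τ w.1)
    induction w.1 with
    | ih1 a => rfl
    | ih2 u v hu hv => simp only [map_mul, hu, hv]

/-- The word substituted for the letter `aⱼ` of the outer monomial when a monomial `v` of arity `m`
is inserted in place of the letter `aᵢ`: letters before `aᵢ` keep their index, letters after it are
shifted by `m - 1`, and `aᵢ` itself is replaced by `v(aᵢ, …, a_{i+m-1})`. -/
def substLetter {n m : ℕ} (i : Fin (n + 1)) (v : FreeMagma (Fin m)) (j : Fin (n + 1)) :
    FreeMagma (Fin (n + m)) :=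
  if hlt : j < i then .of ⟨j, by omega⟩
  else if hgt : i < j then .of ⟨j - 1 + m, by omega⟩
  else FreeMagma.map (fun k : Fin m => (⟨i + k, by omega⟩ : Fin (n + m))) v

theorem isMultilinear_iff {n : ℕ} (w : FreeMagma (Fin n)) :
    IsMultilinear w ↔ (letters w).Nodup ∧ ∀ k, k ∈ letters w := by
  constructor
  · intro h
    rw [IsMultilinear] at h
    rw [h]
    exact ⟨Finset.univ.nodup, fun k => Finset.mem_univ k⟩
  · rintro ⟨h₁, h₂⟩
    exact (Multiset.Nodup.ext h₁ Finset.univ.nodup).2 fun k =>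
      ⟨fun _ => Finset.mem_univ k, fun _ => h₂ k⟩

theorem mem_letters_substLetter {n m : ℕ} (i : Fin (n + 1)) (v : Monomial m) (j : Fin (n + 1))
    (k : Fin (n + m)) :
    k ∈ letters (substLetter i v.1 j) ↔
      ((j < i ∧ k.1 = j.1) ∨ (i < j ∧ k.1 = j.1 - 1 + m) ∨
        (j = i ∧ i.1 ≤ k.1 ∧ k.1 < i.1 + m)) := by
  have hv := ((isMultilinear_iff v.1).1 v.2).2
  unfold substLetter
  split_ifs with h₁ h₂
  · simp only [letters, Multiset.mem_singleton, Fin.ext_iff, Fin.lt_def] at *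
    omega
  · simp only [letters, Multiset.mem_singleton, Fin.ext_iff, Fin.lt_def] at *
    omega
  · rw [letters_map, Multiset.mem_map]
    constructor
    · rintro ⟨a, -, rfl⟩
      simp only [Fin.ext_iff, Fin.lt_def] at *
      omega
    · intro h
      refine ⟨⟨k.1 - i.1, ?_⟩, hv _, ?_⟩ <;> simp only [Fin.ext_iff, Fin.lt_def] at * <;> omega

theorem isMultilinear_subst {n m : ℕ} (i : Fin (n + 1)) (w : Monomial (n + 1)) (v : Monomial m) :
    IsMultilinear (FreeMagma.lift (substLetter i v.1) w.1) := by
  have hw : letters w.1 = Finset.univ.val := w.2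
  rw [isMultilinear_iff, letters_lift, hw]
  constructor
  · rw [Multiset.nodup_bind]
    constructor
    · intro j _
      unfold substLetter
      split_ifs
      · exact Multiset.nodup_singleton _
      · exact Multiset.nodup_singleton _
      · rw [letters_map]
        refine Multiset.Nodup.map ?_ ((isMultilinear_iff v.1).1 v.2).1
        intro a b hab
        simp only [Fin.ext_iff] at *
        omega
    · refine Multiset.Nodup.pairwise (fun a _ b _ hab => ?_) Finset.univ.nodup
      refine Multiset.disjoint_left.2 fun {k} ha hb => ?_
      rw [mem_letters_substLetter] at ha hb
      simp only [Fin.ext_iff, Fin.lt_def, ne_eq] at *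
      omega
  · intro k
    rw [Multiset.mem_bind]
    rcases lt_or_ge k.1 i.1 with h | h
    · exact ⟨⟨k.1, by omega⟩, Finset.mem_univ_val _, (mem_letters_substLetter ..).2 <| .inl
        ⟨h, rfl⟩⟩
    rcases lt_or_ge k.1 (i.1 + m) with h' | h'
    · exact ⟨i, Finset.mem_univ_val _, (mem_letters_substLetter ..).2 <| .inr <| .inr ⟨rfl, h, h'⟩⟩
    · refine ⟨⟨k.1 - m + 1, by omega⟩, Finset.mem_univ_val _, (mem_letters_substLetter ..).2 <|
        .inr <| .inl ⟨?_, ?_⟩⟩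
      · simp only [Fin.lt_def]; omega
      · simp only; omega

/-- Partial composition `w ∘ᵢ v` of monomials: substitute `v(aᵢ, …, a_{i+m-1})` for the `i`-th
argument of `w`. The arity of the result is `(n + 1) + m - 1 = n + m`. -/
def Monomial.comp {n m : ℕ} (i : Fin (n + 1)) (w : Monomial (n + 1)) (v : Monomial m) :
    Monomial (n + m) :=
  ⟨FreeMagma.lift (substLetter i v.1) w.1, isMultilinear_subst i w v⟩

/-! ### The free symmetric operad on one binary operation -/

section Operad

variable (F : Type*) [Field F]

/-- The arity `n` component of the free symmetric operad generated by one binary operation with no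
symmetry: the vector space with basis the multilinear nonassociative monomials in `a₁, …, aₙ`. -/
abbrev FreeOperad (n : ℕ) : Type _ := Monomial n →₀ F

/-- The `Sₙ`-module structure on the arity `n` component, by renaming arguments,
`σ • w(a₁, …, aₙ) = w(a_{σ(1)}, …, a_{σ(n)})`. The right module structure is
`w · σ = σ⁻¹ • w`. -/
def permRep (n : ℕ) : Representation F (Equiv.Perm (Fin n)) (FreeOperad F n) where
  toFun σ := Finsupp.lmapDomain F F (Monomial.relabel σ)
  map_one' := by
    rw [show Monomial.relabel (1 : Equiv.Perm (Fin n)) = id from funext Monomial.relabel_one,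
      Finsupp.lmapDomain_id]
    rfl
  map_mul' σ τ := by
    rw [show Monomial.relabel (σ * τ) = Monomial.relabel σ ∘ Monomial.relabel τ from
      funext (Monomial.relabel_mul σ τ), Finsupp.lmapDomain_comp]
    rfl

variable {F}

/-- Partial composition `p ∘ᵢ q` in the free operad, the bilinear extension of the composition of
monomials. -/
def comp {n m : ℕ} (i : Fin (n + 1)) :
    FreeOperad F (n + 1) →ₗ[F] FreeOperad F m →ₗ[F] FreeOperad F (n + m) :=
  Finsupp.lsum F fun w => LinearMap.toSpanSingleton F _
    (Finsupp.lmapDomain F F (Monomial.comp i w))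

/-- An operad ideal of the free operad: a family of `Sₙ`-submodules closed under composition, on
either side, with arbitrary elements. -/
structure IsOperadIdeal (J : ∀ n : ℕ, Submodule F (FreeOperad F n)) : Prop where
  perm_mem : ∀ (n : ℕ) (σ : Equiv.Perm (Fin n)) (p : FreeOperad F n),
    p ∈ J n → permRep F n σ p ∈ J n
  comp_mem_left : ∀ (n m : ℕ) (i : Fin (n + 1)) (p : FreeOperad F (n + 1)) (q : FreeOperad F m),
    p ∈ J (n + 1) → comp i p q ∈ J (n + m)
  comp_mem_right : ∀ (n m : ℕ) (i : Fin (n + 1)) (p : FreeOperad F (n + 1)) (q : FreeOperad F m),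
    q ∈ J m → comp i p q ∈ J (n + m)

/-- The operad ideal generated by one quadratic (arity three) relation: the intersection of all
operad ideals that contain it. -/
def idealGen (ρ : FreeOperad F 3) (n : ℕ) : Submodule F (FreeOperad F n) :=
  ⨅ (J : ∀ n : ℕ, Submodule F (FreeOperad F n)) (_ : IsOperadIdeal J) (_ : ρ ∈ J 3), J n

theorem mem_idealGen {ρ : FreeOperad F 3} {n : ℕ} {p : FreeOperad F n} :
    p ∈ idealGen ρ n ↔
      ∀ J : ∀ n : ℕ, Submodule F (FreeOperad F n), IsOperadIdeal J → ρ ∈ J 3 → p ∈ J n := by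
  simp [idealGen, Submodule.mem_iInf]

theorem isOperadIdeal_idealGen (ρ : FreeOperad F 3) : IsOperadIdeal (idealGen ρ) where
  perm_mem n σ p hp := mem_idealGen.2 fun J hJ hρ =>
    hJ.perm_mem n σ p (mem_idealGen.1 hp J hJ hρ)
  comp_mem_left n m i p q hp := mem_idealGen.2 fun J hJ hρ =>
    hJ.comp_mem_left n m i p q (mem_idealGen.1 hp J hJ hρ)
  comp_mem_right n m i p q hq := mem_idealGen.2 fun J hJ hρ =>
    hJ.comp_mem_right n m i p q (mem_idealGen.1 hq J hJ hρ)

/-- The arity `n` component of the quotient of the free operad by the ideal generated by `ρ`. -/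
abbrev QuotientOperad (ρ : FreeOperad F 3) (n : ℕ) : Type _ := FreeOperad F n ⧸ idealGen ρ n

/-- The `Sₙ`-module structure on the arity `n` component of the quotient operad. -/
def quotientRep (ρ : FreeOperad F 3) (n : ℕ) :
    Representation F (Equiv.Perm (Fin n)) (QuotientOperad ρ n) :=
  (permRep F n).quotient (idealGen ρ n) fun σ p hp =>
    (isOperadIdeal_idealGen ρ).perm_mem n σ p hp

/-- The relation `ρ` is regular: for all `n ≥ 1` the arity `n` component of the operad that it
defines is isomorphic to the regular module `F Sₙ`. -/
def IsRegular (ρ : FreeOperad F 3) : Prop :=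
  ∀ n : ℕ, 1 ≤ n → Nonempty
    (Representation.Equiv (quotientRep ρ n) (Representation.leftRegular F (Equiv.Perm (Fin n))))

/-! ### Relations of arity three -/

instance {n : ℕ} (w : FreeMagma (Fin n)) : Decidable (IsMultilinear w) :=
  inferInstanceAs (Decidable (letters w = Finset.univ.val))

variable (F) in
/-- The monomial `(aᵢ aⱼ) aₖ` of arity three, where `i, j, k` are the three indices in some order;
the arguments `a₁, a₂, a₃` have the indices `0, 1, 2`. -/
def lmon (i j k : Fin 3) (h : IsMultilinear (.of i * .of j * .of k) := by decide) :
    FreeOperad F 3 :=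
  Finsupp.single ⟨.of i * .of j * .of k, h⟩ 1

variable (F) in
/-- The monomial `aᵢ (aⱼ aₖ)` of arity three. -/
def rmon (i j k : Fin 3) (h : IsMultilinear (.of i * (.of j * .of k)) := by decide) :
    FreeOperad F 3 :=
  Finsupp.single ⟨.of i * (.of j * .of k), h⟩ 1

/-- The relation `(a₁a₂)a₃ = x₁ a₁(a₂a₃) + x₂ a₁(a₃a₂) + x₃ a₂(a₁a₃) + x₄ a₂(a₃a₁) +
x₅ a₃(a₁a₂) + x₆ a₃(a₂a₁)`, as the difference of its two sides. -/
def lrRelation (x₁ x₂ x₃ x₄ x₅ x₆ : F) : FreeOperad F 3 :=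
  lmon F 0 1 2 -
    (x₁ • rmon F 0 1 2 + x₂ • rmon F 0 2 1 + x₃ • rmon F 1 0 2 + x₄ • rmon F 1 2 0 +
      x₅ • rmon F 2 0 1 + x₆ • rmon F 2 1 0)

variable (F) in
/-- The left-nilpotent identity `(a₁a₂)a₃ = 0`. -/
def leftNilpotentRelation : FreeOperad F 3 := lmon F 0 1 2

variable (F) in
/-- Associativity `(a₁a₂)a₃ = a₁(a₂a₃)`. -/
def associativeRelation : FreeOperad F 3 := lmon F 0 1 2 - rmon F 0 1 2

variable (F) in
/-- The (right) Zinbiel identity `(a₁a₂)a₃ = a₁(a₂a₃) + a₁(a₃a₂)`. -/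
def zinbielRelation : FreeOperad F 3 := lmon F 0 1 2 - (rmon F 0 1 2 + rmon F 0 2 1)

variable (F) in
/-- The (left) Leibniz identity `(a₁a₂)a₃ = a₁(a₂a₃) - a₂(a₁a₃)`. -/
def leibnizRelation : FreeOperad F 3 := lmon F 0 1 2 - (rmon F 0 1 2 - rmon F 1 0 2)

end Operad

end LROperad

end

/-! When `x₅ = x₆ = 0`, the relation rewrites `(ab)c` into products whose outer left factor is `a`
or `b`, so that repeated rewriting turns every word into a combination of right-normed words
`a₁(a₂(⋯aₙ))` (`SatisfiesLR.comb_mul_comb_mem`). In arity `n` there are `n!` multilinear ones,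
permuted simply transitively by `Sₙ`. Hence the regular module always surjects onto the quotient
component (`combMap_surjective`), and regularity means exactly that the right-normed monomials are
linearly independent in every arity.

Sufficiency: for each of the four points an algebra satisfying the relation is exhibited in which
the right-normed monomials are separated by linear functionals. Three points share one construction,
an algebra with product `αxy + βyx` acting by left multiplication on a second copy of the
associative algebra (`hemiMul`); the Zinbiel point uses unions of finite subsets of a linear order
(`setMul`).

Necessity: reducing `((ab)c)d` from the outer and from the inner product gives a linear relation
between right-normed words of arity four (`SatisfiesLR.overlap`). Independence makes its
coefficients vanish, and these polynomial equations have only the four solutions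
(`point_of_equations`).

Rewriting is carried out in algebras rather than in the operad. The relatively free algebra of an
operad ideal, projected to its multilinear part, carries the results back to the quotient operad. -/

noncomputable section

namespace LROperad

variable {F : Type*} [Field F]

section Eval

variable {X Y : Type*} {A : Type*} [AddCommGroup A] [Module F A]

/-! ### Evaluation of nonassociative words -/

/-- The value of a nonassociative word for the product `μ`, with the letters replaced by `f`. -/
def evalWord (μ : A →ₗ[F] A →ₗ[F] A) (f : X → A) : FreeMagma X → A
  | .of x => f x
  | .mul u v => μ (evalWord μ f u) (evalWord μ f v)

@[simp]
theorem evalWord_of (μ : A →ₗ[F] A →ₗ[F] A) (f : X → A) (x : X) :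
    evalWord μ f (.of x) = f x := rfl

@[simp]
theorem evalWord_mul (μ : A →ₗ[F] A →ₗ[F] A) (f : X → A) (u v : FreeMagma X) :
    evalWord μ f (u * v) = μ (evalWord μ f u) (evalWord μ f v) := rfl

theorem evalWord_lift (μ : A →ₗ[F] A →ₗ[F] A) (f : Y → A) (g : X → FreeMagma Y)
    (w : FreeMagma X) :
    evalWord μ f (FreeMagma.lift g w) = evalWord μ (fun x => evalWord μ f (g x)) w := by
  induction w with
  | ih1 a => simp
  | ih2 u v hu hv => simp [hu, hv]

theorem evalWord_map (μ : A →ₗ[F] A →ₗ[F] A) (f : Y → A) (g : X → Y) (w : FreeMagma X) :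
    evalWord μ f (FreeMagma.map g w) = evalWord μ (fun x => f (g x)) w :=
  evalWord_lift μ f (fun x => .of (g x)) w

theorem evalWord_congr (μ : A →ₗ[F] A →ₗ[F] A) {f g : X → A} (w : FreeMagma X)
    (h : ∀ x ∈ letters w, f x = g x) : evalWord μ f w = evalWord μ g w := by
  induction w with
  | ih1 a => exact h a (by simp [letters])
  | ih2 u v hu hv =>
    rw [evalWord_mul, evalWord_mul, hu fun x hx => h x (Multiset.mem_add.2 (.inl hx)),
      hv fun x hx => h x (Multiset.mem_add.2 (.inr hx))]

/-- The evaluation of elements of the free operad on arguments from an algebra. -/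
def eval (μ : A →ₗ[F] A →ₗ[F] A) {n : ℕ} (f : Fin n → A) : FreeOperad F n →ₗ[F] A :=
  Finsupp.linearCombination F fun w : Monomial n => evalWord μ f w.1

@[simp]
theorem eval_single (μ : A →ₗ[F] A →ₗ[F] A) {n : ℕ} (f : Fin n → A) (w : Monomial n) (c : F) :
    eval μ f (Finsupp.single w c) = c • evalWord μ f w.1 := by
  simp [eval]

theorem permRep_single {n : ℕ} (σ : Equiv.Perm (Fin n)) (w : Monomial n) (c : F) :
    permRep F n σ (Finsupp.single w c) = Finsupp.single (w.relabel σ) c := by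
  change Finsupp.lmapDomain F F (Monomial.relabel σ) _ = _
  simp

theorem comp_single {n m : ℕ} (i : Fin (n + 1)) (w : Monomial (n + 1)) (v : Monomial m) (c d : F) :
    comp i (Finsupp.single w c) (Finsupp.single v d) = Finsupp.single (w.comp i v) (c * d) := by
  simp [comp]

theorem eval_permRep (μ : A →ₗ[F] A →ₗ[F] A) {n : ℕ} (f : Fin n → A) (σ : Equiv.Perm (Fin n))
    (p : FreeOperad F n) : eval μ f (permRep F n σ p) = eval μ (f ∘ σ) p := by
  induction p using Finsupp.induction_linear with
  | zero => simp
  | add p q hp hq => simp only [map_add, hp, hq]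
  | single w c =>
    rw [permRep_single, eval_single, eval_single, Monomial.relabel, evalWord_map]
    rfl

theorem eval_comp_single_right (μ : A →ₗ[F] A →ₗ[F] A) {n m : ℕ} (f : Fin (n + m) → A)
    (i : Fin (n + 1)) (p : FreeOperad F (n + 1)) (v : Monomial m) :
    eval μ f (comp i p (Finsupp.single v 1)) =
      eval μ (fun j => evalWord μ f (substLetter i v.1 j)) p := by
  induction p using Finsupp.induction_linear with
  | zero => simp
  | add p q hp hq => simp only [map_add, LinearMap.add_apply, hp, hq]
  | single w c =>
    rw [comp_single, eval_single, eval_single, Monomial.comp, evalWord_lift, mul_one]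

/-- The value of a word is linear in a letter that occurs once. -/
theorem exists_linear_evalWord_update [DecidableEq X] (μ : A →ₗ[F] A →ₗ[F] A) (f : X → A) (x : X)
    (w : FreeMagma X) (hw : (letters w).Nodup) (hx : x ∈ letters w) :
    ∃ L : A →ₗ[F] A, ∀ a, evalWord μ (Function.update f x a) w = L a := by
  induction w with
  | ih1 b =>
    obtain rfl : x = b := by simpa [letters] using hx
    exact ⟨LinearMap.id, fun a => by simp⟩
  | ih2 u v hu hv =>
    have hd : (letters u + letters v).Nodup := hw
    obtain ⟨h₁, h₂, h₃⟩ := Multiset.nodup_add.1 hd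
    have key : ∀ t : FreeMagma X, x ∉ letters t →
        ∀ a, evalWord μ (Function.update f x a) t = evalWord μ f t := fun t ht a =>
      evalWord_congr μ t fun y hy => Function.update_of_ne (ne_of_mem_of_not_mem hy ht) _ _
    rcases Multiset.mem_add.1 (show x ∈ letters u + letters v from hx) with h | h
    · obtain ⟨L, hL⟩ := hu h₁ h
      refine ⟨(μ.flip (evalWord μ f v)) ∘ₗ L, fun a => ?_⟩
      rw [evalWord_mul, hL, key v (Multiset.disjoint_left.1 h₃ h)]
      rfl
    · obtain ⟨L, hL⟩ := hv h₂ h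
      refine ⟨(μ (evalWord μ f u)) ∘ₗ L, fun a => ?_⟩
      rw [evalWord_mul, hL, key u (Multiset.disjoint_right.1 h₃ h)]
      rfl

/-! ### The operad ideal of identities of an algebra -/

/-- The elements of the free operad that vanish identically in an algebra. -/
def identities (μ : A →ₗ[F] A →ₗ[F] A) (n : ℕ) : Submodule F (FreeOperad F n) :=
  ⨅ f : Fin n → A, LinearMap.ker (eval μ f)

theorem mem_identities {μ : A →ₗ[F] A →ₗ[F] A} {n : ℕ} {p : FreeOperad F n} :
    p ∈ identities μ n ↔ ∀ f : Fin n → A, eval μ f p = 0 := by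
  simp [identities, Submodule.mem_iInf]

/-- Relabelling, or inserting a monomial into an identity, only changes the arguments at which it is
evaluated. Inserting an identity into a monomial gives zero because a multilinear word is linear in
the letter replaced. -/
theorem isOperadIdeal_identities (μ : A →ₗ[F] A →ₗ[F] A) : IsOperadIdeal (identities μ) where
  perm_mem n σ p hp := mem_identities.2 fun f => by
    rw [eval_permRep]
    exact mem_identities.1 hp _
  comp_mem_left n m i p q hp := mem_identities.2 fun f => by
    induction q using Finsupp.induction_linear with
    | zero => simp
    | add q r hq hr => rw [map_add, map_add, hq, hr, add_zero]
    | single v c =>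
      rw [← mul_one c, ← smul_eq_mul, ← Finsupp.smul_single, map_smul, map_smul,
        eval_comp_single_right, mem_identities.1 hp, smul_zero]
  comp_mem_right n m i p q hq := mem_identities.2 fun f => by
    induction p using Finsupp.induction_linear with
    | zero => simp
    | add p r hp hr => rw [map_add, LinearMap.add_apply, map_add, hp, hr, add_zero]
    | single w c =>
      obtain ⟨hn, hall⟩ := (isMultilinear_iff w.1).1 w.2
      -- `g` lists the arguments of the outer word after the insertion. The default `0` at `i` is
      -- immaterial, since that entry is always updated.
      let g : Fin (n + 1) → A := fun j =>
        if h : j < i then f ⟨j, by omega⟩ else if h' : i < j then f ⟨j - 1 + m, by omega⟩ else 0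
      let s : Fin m → Fin (n + m) := fun k => ⟨i + k, by omega⟩
      obtain ⟨L, hL⟩ := exists_linear_evalWord_update μ g i w.1 hn (hall i)
      have key : ∀ r : FreeOperad F m,
          eval μ f (comp i (Finsupp.single w c) r) = c • L (eval μ (f ∘ s) r) := by
        intro r
        induction r using Finsupp.induction_linear with
        | zero => simp
        | add r t hr ht => simp only [map_add, smul_add, hr, ht]
        | single v d =>
          rw [comp_single, eval_single, Monomial.comp, evalWord_lift, eval_single, map_smul,
            ← hL, smul_smul]
          congr 1
          refine evalWord_congr μ _ fun j _ => ?_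
          unfold substLetter
          rcases lt_trichotomy j i with h | h | h
          · simp [h, h.ne, g]
          · subst h
            simp only [lt_irrefl, dite_false, Function.update_self]
            rw [evalWord_map]
            rfl
          · simp [h, h.ne', h.not_gt, g]
      rw [key, mem_identities.1 hq, map_zero, smul_zero]

theorem eval_lrRelation (μ : A →ₗ[F] A →ₗ[F] A) (x₁ x₂ x₃ x₄ x₅ x₆ : F) (f : Fin 3 → A) :
    eval μ f (lrRelation x₁ x₂ x₃ x₄ x₅ x₆) = μ (μ (f 0) (f 1)) (f 2) -
      (x₁ • μ (f 0) (μ (f 1) (f 2)) + x₂ • μ (f 0) (μ (f 2) (f 1)) +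
       x₃ • μ (f 1) (μ (f 0) (f 2)) + x₄ • μ (f 1) (μ (f 2) (f 0)) +
       x₅ • μ (f 2) (μ (f 0) (f 1)) + x₆ • μ (f 2) (μ (f 1) (f 0))) := by
  simp only [lrRelation, lmon, rmon, map_sub, map_add, map_smul, eval_single, evalWord_mul,
    evalWord_of, one_smul]

/-- The product `μ` satisfies
`(ab)c = x₁ a(bc) + x₂ a(cb) + x₃ b(ac) + x₄ b(ca)`. -/
def SatisfiesLR (μ : A →ₗ[F] A →ₗ[F] A) (x₁ x₂ x₃ x₄ : F) : Prop :=
  ∀ a b c, μ (μ a b) c =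
    x₁ • μ a (μ b c) + x₂ • μ a (μ c b) + x₃ • μ b (μ a c) + x₄ • μ b (μ c a)

theorem SatisfiesLR.idealGen_le {μ : A →ₗ[F] A →ₗ[F] A} {x₁ x₂ x₃ x₄ : F}
    (h : SatisfiesLR μ x₁ x₂ x₃ x₄) (n : ℕ) :
    idealGen (lrRelation x₁ x₂ x₃ x₄ 0 0) n ≤ identities μ n := fun _ hp =>
  mem_idealGen.1 hp _ (isOperadIdeal_identities μ) <| mem_identities.2 fun f => by
    rw [eval_lrRelation, h]
    simp

/-! ### Right-normed words -/

/-- The right-normed word `a₁(a₂(⋯(aₖ z)))`, where `l = [a₁, …, aₖ]`. -/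
def comb (l : List X) (z : X) : FreeMagma X :=
  l.foldr (fun a w => .of a * w) (.of z)

@[simp]
theorem comb_nil (z : X) : comb [] z = .of z := rfl

@[simp]
theorem comb_cons (a : X) (l : List X) (z : X) : comb (a :: l) z = .of a * comb l z := rfl

theorem letters_comb (l : List X) (z : X) : letters (comb l z) = (l ++ [z] : List X) := by
  induction l with
  | nil => rfl
  | cons a l ih =>
    change {a} + letters (comb l z) = _
    rw [ih]
    rfl

theorem map_comb (f : X → Y) (l : List X) (z : X) :
    FreeMagma.map f (comb l z) = comb (l.map f) (f z) := by
  induction l with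
  | nil => rfl
  | cons a l ih => rw [comb_cons, map_mul, ih]; rfl

/-- The span of the values of the right-normed words with given letters. -/
def combSpan (μ : A →ₗ[F] A →ₗ[F] A) (f : X → A) (s : Multiset X) : Submodule F A :=
  Submodule.span F {a | ∃ l z, ((l ++ [z] : List X) : Multiset X) = s ∧
    evalWord μ f (comb l z) = a}

theorem evalWord_comb_mem (μ : A →ₗ[F] A →ₗ[F] A) (f : X → A) (l : List X) (z : X) :
    evalWord μ f (comb l z) ∈ combSpan μ f (l ++ [z] : List X) :=
  Submodule.subset_span ⟨l, z, rfl, rfl⟩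

/-- A linear map into a submodule is tested on the right-normed words. -/
theorem combSpan_induction {μ : A →ₗ[F] A →ₗ[F] A} {f : X → A} {s : Multiset X} (T : A →ₗ[F] A)
    (V : Submodule F A)
    (h : ∀ l z, ((l ++ [z] : List X) : Multiset X) = s → T (evalWord μ f (comb l z)) ∈ V)
    {a : A} (ha : a ∈ combSpan μ f s) : T a ∈ V := by
  have : combSpan μ f s ≤ V.comap T := Submodule.span_le.2 <| by
    rintro _ ⟨l, z, hl, rfl⟩
    exact h l z hl
  exact this ha

theorem letter_mul_mem_combSpan {μ : A →ₗ[F] A →ₗ[F] A} {f : X → A} {s : Multiset X} (x : X)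
    {a : A} (ha : a ∈ combSpan μ f s) : μ (f x) a ∈ combSpan μ f (x ::ₘ s) :=
  combSpan_induction (μ (f x)) (combSpan μ f (x ::ₘ s)) (fun l z hl => Submodule.subset_span
    ⟨x :: l, z, by rw [← hl]; rfl, rfl⟩) ha

/-- Termination of the rewriting: double induction, on the total number of letters and then on the
length of the left factor. For a left factor `a·u` and right factor `v`, the relation produces
`a(uv)`, `a(vu)`, `u(av)` and `u(va)`; the first two contain a product with fewer letters, the last
two have the shorter left factor `u`. -/
theorem SatisfiesLR.comb_mul_comb_mem {μ : A →ₗ[F] A →ₗ[F] A} {x₁ x₂ x₃ x₄ : F}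
    (h : SatisfiesLR μ x₁ x₂ x₃ x₄) (f : X → A) (N : ℕ) :
    ∀ (l : List X) (y : X) (m : List X) (z : X), l.length + m.length ≤ N →
      μ (evalWord μ f (comb l y)) (evalWord μ f (comb m z)) ∈
        combSpan μ f ((l ++ [y] : List X) + (m ++ [z] : List X) : Multiset X) := by
  induction N using Nat.strong_induction_on with
  | _ N ih =>
  intro l
  induction l with
  | nil =>
    intro y m z _
    exact evalWord_comb_mem μ f (y :: m) z
  | cons a l ihl =>
    intro y m z hN
    simp only [List.length_cons] at hN
    rw [comb_cons, evalWord_mul, evalWord_of, h]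
    have e : (((a :: l) ++ [y] : List X) + (m ++ [z] : List X) : Multiset X) =
        a ::ₘ ((l ++ [y] : List X) + (m ++ [z] : List X) : Multiset X) := by
      rw [← Multiset.cons_add]; rfl
    refine add_mem (add_mem (add_mem ?_ ?_) ?_) ?_ <;> refine Submodule.smul_mem _ _ ?_
    · rw [e]
      exact letter_mul_mem_combSpan a (ih (N - 1) (by omega) l y m z (by omega))
    · rw [e, add_comm]
      exact letter_mul_mem_combSpan a (ih (N - 1) (by omega) m z l y (by omega))
    -- `u(av)`: here `av` is already right-normed, and the left factor has lost a letter.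
    · have := ihl y (a :: m) z (by simp only [List.length_cons]; omega)
      rw [e, ← Multiset.add_cons]
      exact this
    -- `u(va)`: the product `va` has fewer letters and is straightened by the outer induction; the
    -- inner induction then handles `u` times each resulting word.
    · have key := ih (N - 1) (by omega) m z [] a (by simp only [List.length_nil]; omega)
      refine combSpan_induction (μ (evalWord μ f (comb l y))) _ (fun l' z' hl' => ?_) key
      have hlen := congrArg Multiset.card hl'
      simp only [Multiset.coe_card, Multiset.card_add, List.length_append, List.length_singleton,
        List.length_nil] at hlen
      have := ihl y l' z' (by omega)
      rw [hl'] at this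
      rw [e, ← Multiset.add_cons, ← Multiset.singleton_add, add_comm {a} (_ : Multiset X)]
      exact this

/-- If `μ` satisfies the relation, then every word is a combination of right-normed words in the
same letters. -/
theorem SatisfiesLR.evalWord_mem_combSpan {μ : A →ₗ[F] A →ₗ[F] A} {x₁ x₂ x₃ x₄ : F}
    (h : SatisfiesLR μ x₁ x₂ x₃ x₄) (f : X → A) (w : FreeMagma X) :
    evalWord μ f w ∈ combSpan μ f (letters w) := by
  induction w with
  | ih1 a => exact evalWord_comb_mem μ f [] a
  | ih2 u v hu hv =>
    rw [evalWord_mul]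
    change _ ∈ combSpan μ f (letters u + letters v)
    refine combSpan_induction (μ (evalWord μ f u)) _ (fun m z hm => ?_) hv
    refine combSpan_induction (μ.flip (evalWord μ f (comb m z))) _ (fun l y hl => ?_) hu
    rw [← hm, ← hl]
    exact h.comb_mul_comb_mem f _ l y m z le_rfl

end Eval

section RelativelyFree

variable {X Y : Type*}

/-! ### The relatively free algebra of an operad ideal -/

theorem lift_lift {Z : Type*} (f : Y → FreeMagma Z) (g : X → FreeMagma Y) (w : FreeMagma X) :
    FreeMagma.lift f (FreeMagma.lift g w) = FreeMagma.lift (fun x => FreeMagma.lift f (g x)) w := by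
  induction w with
  | ih1 a => simp
  | ih2 u v hu hv => simp only [map_mul, hu, hv]

theorem lift_map {Z : Type*} (f : Y → FreeMagma Z) (g : X → Y) (w : FreeMagma X) :
    FreeMagma.lift f (FreeMagma.map g w) = FreeMagma.lift (fun x => f (g x)) w :=
  lift_lift f (fun x => .of (g x)) w

variable (F X) in
/-- The product of the free nonassociative algebra on `X`. -/
def freeMul : (FreeMagma X →₀ F) →ₗ[F] (FreeMagma X →₀ F) →ₗ[F] (FreeMagma X →₀ F) :=
  Finsupp.lsum F fun u => LinearMap.toSpanSingleton F _ (Finsupp.lmapDomain F F (u * ·))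

@[simp]
theorem freeMul_single (u v : FreeMagma X) (c d : F) :
    freeMul F X (Finsupp.single u c) (Finsupp.single v d) = Finsupp.single (u * v) (c * d) := by
  simp [freeMul]

/-- Substitution of words for the arguments of an element of the free operad. -/
def substWords {n : ℕ} (f : Fin n → FreeMagma X) : FreeOperad F n →ₗ[F] (FreeMagma X →₀ F) :=
  Finsupp.lmapDomain F F fun w : Monomial n => FreeMagma.lift f w.1

@[simp]
theorem substWords_single {n : ℕ} (f : Fin n → FreeMagma X) (w : Monomial n) (c : F) :
    substWords f (Finsupp.single w c) = Finsupp.single (FreeMagma.lift f w.1) c := by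
  simp [substWords]

/-- The ideal of the free nonassociative algebra formed by the values of an operad ideal. -/
def valueIdeal (J : ∀ n : ℕ, Submodule F (FreeOperad F n)) (X : Type*) :
    Submodule F (FreeMagma X →₀ F) :=
  Submodule.span F {z | ∃ (n : ℕ) (f : Fin n → FreeMagma X) (p : FreeOperad F n),
    p ∈ J n ∧ substWords f p = z}

variable (F) in
/-- The generating operation `a₁a₂` of the free operad. -/
def binaryOp : FreeOperad F 2 :=
  Finsupp.single ⟨.of 0 * .of 1, by decide⟩ 1

variable {J : ∀ n : ℕ, Submodule F (FreeOperad F n)}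

/-- If `z` is a value of `p`, then `uz` is a value of `a₁a₂` with `p` inserted for `a₂`, the new
first argument being `u`. -/
theorem word_mul_mem_valueIdeal (hJ : IsOperadIdeal J) (u : FreeMagma X) {z : FreeMagma X →₀ F}
    (hz : z ∈ valueIdeal J X) : freeMul F X (Finsupp.single u 1) z ∈ valueIdeal J X := by
  suffices valueIdeal J X ≤ (valueIdeal J X).comap (freeMul F X (Finsupp.single u 1)) from this hz
  refine Submodule.span_le.2 ?_
  rintro _ ⟨n, f, p, hp, rfl⟩
  refine Submodule.subset_span ⟨1 + n,
    fun k => if h : k.1 = 0 then u else f ⟨k.1 - 1, by omega⟩,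
    comp (1 : Fin (1 + 1)) (binaryOp F) p, hJ.comp_mem_right 1 n 1 _ p hp, ?_⟩
  clear hp
  induction p using Finsupp.induction_linear with
  | zero => simp
  | add p q hp hq => simp only [map_add, hp, hq]
  | single w c =>
    rw [binaryOp, comp_single, substWords_single, substWords_single, freeMul_single]
    congr 1
    simp [Monomial.comp, substLetter, lift_map]

theorem mul_word_mem_valueIdeal (hJ : IsOperadIdeal J) (u : FreeMagma X) {z : FreeMagma X →₀ F}
    (hz : z ∈ valueIdeal J X) : freeMul F X z (Finsupp.single u 1) ∈ valueIdeal J X := by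
  suffices valueIdeal J X ≤ (valueIdeal J X).comap ((freeMul F X).flip (Finsupp.single u 1)) from
    this hz
  refine Submodule.span_le.2 ?_
  rintro _ ⟨n, f, p, hp, rfl⟩
  refine Submodule.subset_span ⟨1 + n,
    fun k => if h : k.1 < n then f ⟨k.1, h⟩ else u,
    comp (0 : Fin (1 + 1)) (binaryOp F) p, hJ.comp_mem_right 1 n 0 _ p hp, ?_⟩
  clear hp
  induction p using Finsupp.induction_linear with
  | zero => simp
  | add p q hp hq => simp only [map_add, hp, hq]
  | single w c =>
    rw [binaryOp, comp_single, substWords_single, substWords_single, LinearMap.flip_apply,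
      freeMul_single, mul_comm]
    congr 1
    simp [Monomial.comp, substLetter, lift_map]

theorem freeMul_mem_left (hJ : IsOperadIdeal J) (y : FreeMagma X →₀ F) {z : FreeMagma X →₀ F}
    (hz : z ∈ valueIdeal J X) : freeMul F X y z ∈ valueIdeal J X := by
  induction y using Finsupp.induction_linear with
  | zero => simp
  | add p q hp hq => rw [map_add]; exact add_mem hp hq
  | single w c =>
    rw [← mul_one c, ← smul_eq_mul, ← Finsupp.smul_single, map_smul]
    exact Submodule.smul_mem _ c (word_mul_mem_valueIdeal hJ w hz)

theorem freeMul_mem_right (hJ : IsOperadIdeal J) (y : FreeMagma X →₀ F) {z : FreeMagma X →₀ F}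
    (hz : z ∈ valueIdeal J X) : freeMul F X z y ∈ valueIdeal J X := by
  induction y using Finsupp.induction_linear with
  | zero => simp
  | add p q hp hq => rw [map_add]; exact add_mem hp hq
  | single w c =>
    rw [← mul_one c, ← smul_eq_mul, ← Finsupp.smul_single, map_smul]
    exact Submodule.smul_mem _ c (mul_word_mem_valueIdeal hJ w hz)

/-- The product of the relatively free algebra. -/
def relMul (hJ : IsOperadIdeal J) (X : Type*) :
    ((FreeMagma X →₀ F) ⧸ valueIdeal J X) →ₗ[F] ((FreeMagma X →₀ F) ⧸ valueIdeal J X) →ₗ[F]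
      ((FreeMagma X →₀ F) ⧸ valueIdeal J X) :=
  (valueIdeal J X).liftQ
    (((valueIdeal J X).liftQ ((freeMul F X).compr₂ (valueIdeal J X).mkQ).flip fun z hz => by
      refine LinearMap.mem_ker.2 (LinearMap.ext fun y => ?_)
      exact (Submodule.Quotient.mk_eq_zero _).2 (freeMul_mem_left hJ y hz)).flip) fun z hz => by
    refine LinearMap.mem_ker.2 (LinearMap.ext fun y => ?_)
    induction y using Submodule.Quotient.induction_on with
    | H y => exact (Submodule.Quotient.mk_eq_zero _).2 (freeMul_mem_right hJ y hz)

theorem relMul_mk (hJ : IsOperadIdeal J) (y z : FreeMagma X →₀ F) :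
    relMul hJ X ((valueIdeal J X).mkQ y) ((valueIdeal J X).mkQ z) =
      (valueIdeal J X).mkQ (freeMul F X y z) := rfl

/-- The generators of the relatively free algebra. -/
def relGen (J : ∀ n : ℕ, Submodule F (FreeOperad F n)) {X : Type*} (x : X) :
    (FreeMagma X →₀ F) ⧸ valueIdeal J X :=
  (valueIdeal J X).mkQ (Finsupp.single (.of x) 1)

theorem evalWord_relGen (hJ : IsOperadIdeal J) (w : FreeMagma X) :
    evalWord (relMul hJ X) (relGen J) w = (valueIdeal J X).mkQ (Finsupp.single w 1) := by
  induction w with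
  | ih1 a => rfl
  | ih2 u v hu hv => rw [evalWord_mul, hu, hv, relMul_mk, freeMul_single, mul_one]

/-- Both sides are trilinear, so it is enough to take three words, and there the difference of the
sides is a value of the relation. -/
theorem relMul_satisfiesLR {x₁ x₂ x₃ x₄ : F} (hJ : IsOperadIdeal J)
    (h : lrRelation x₁ x₂ x₃ x₄ 0 0 ∈ J 3) (X : Type*) :
    SatisfiesLR (relMul hJ X) x₁ x₂ x₃ x₄ := by
  intro a b c
  induction a using Submodule.Quotient.induction_on with | H a => ?_
  induction b using Submodule.Quotient.induction_on with | H b => ?_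
  induction c using Submodule.Quotient.induction_on with | H c => ?_
  simp only [← Submodule.mkQ_apply]
  induction a using Finsupp.induction_linear with
  | zero => simp
  | add p q hp hq => simp only [map_add, LinearMap.add_apply, hp, hq, smul_add]; abel
  | single u r =>
  induction b using Finsupp.induction_linear with
  | zero => simp
  | add p q hp hq => simp only [map_add, LinearMap.add_apply, hp, hq, smul_add]; abel
  | single v s =>
  induction c using Finsupp.induction_linear with
  | zero => simp
  | add p q hp hq => simp only [map_add, LinearMap.add_apply, hp, hq, smul_add]; abel
  | single w t =>
    have hmem : (valueIdeal J X).mkQ (substWords ![u, v, w] (lrRelation x₁ x₂ x₃ x₄ 0 0)) = 0 :=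
      (Submodule.Quotient.mk_eq_zero _).2 (Submodule.subset_span ⟨3, _, _, h, rfl⟩)
    simp only [lrRelation, lmon, rmon, map_sub, map_add, map_smul, substWords_single, map_mul,
      FreeMagma.lift_of, zero_smul, add_zero, Matrix.cons_val, sub_eq_zero] at hmem
    have hs : ∀ (w : FreeMagma X) (r : F), Finsupp.single w r = r • Finsupp.single w 1 := by simp
    simp only [relMul_mk, freeMul_single]
    rw [hs (u * v * w), hs (u * (v * w)), hs (u * (w * v)), hs (v * (u * w)), hs (v * (w * u))]
    simp only [map_smul, hmem, smul_add, smul_smul]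
    module

/-! ### The multilinear part -/

variable (F) in
/-- The projection of the free nonassociative algebra on `n` generators to its multilinear part. -/
def multilinearPart (n : ℕ) : (FreeMagma (Fin n) →₀ F) →ₗ[F] FreeOperad F n :=
  Finsupp.lcomapDomain Subtype.val Subtype.val_injective

theorem multilinearPart_single {n : ℕ} (w : Monomial n) (c : F) :
    multilinearPart F n (Finsupp.single w.1 c) = Finsupp.single w c := by
  ext v
  simp [multilinearPart, Finsupp.single_apply, Subtype.ext_iff]

theorem multilinearPart_single_of_not {n : ℕ} {w : FreeMagma (Fin n)} (h : ¬ IsMultilinear w)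
    (c : F) : multilinearPart F n (Finsupp.single w c) = 0 := by
  ext v
  have : w ≠ v.1 := fun e => h (e ▸ v.2)
  simp [multilinearPart, Finsupp.comapDomain_apply, this]

/-- The degree of a word, minus one. -/
def mulCount : FreeMagma X → ℕ
  | .of _ => 0
  | .mul u v => mulCount u + mulCount v + 1

/-- A substitution of words into an element of an operad ideal is a substitution of letters into
another element of the ideal. -/
theorem exists_letter_subst (hJ : IsOperadIdeal J) (N : ℕ) :
    ∀ (n : ℕ) (f : Fin n → FreeMagma X) (p : FreeOperad F n), p ∈ J n →
      ∑ i, mulCount (f i) = N →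
      ∃ (m : ℕ) (g : Fin m → X) (q : FreeOperad F m), q ∈ J m ∧
        substWords f p = substWords (fun i => .of (g i)) q := by
  induction N with
  | zero =>
    intro n f p hp hN
    have : ∀ i, ∃ x, f i = .of x := fun i => by
      have h0 := Finset.sum_eq_zero_iff.1 hN i (Finset.mem_univ i)
      match hf : f i with
      | .of x => exact ⟨x, rfl⟩
      | .mul u v => rw [hf] at h0; simp [mulCount] at h0
    choose g hg using this
    exact ⟨n, g, p, hp, by rw [funext hg]⟩
  | succ N ih =>
    intro n f p hp hN
    obtain ⟨i, -, hi⟩ := Finset.exists_ne_zero_of_sum_ne_zero (hN.trans_ne N.succ_ne_zero)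
    obtain ⟨n, rfl⟩ : ∃ k, n = k + 1 := ⟨n - 1, by have := i.2; omega⟩
    match hf : f i with
    | .of x => rw [hf] at hi; simp [mulCount] at hi
    | .mul u v =>
    -- Composing `p` with `a₁a₂` at `i` splits the argument `uv` into two: `u` stands at position
    -- `i`, `v` at `i + 1`, and later arguments move up by one. One multiplication is lost, which
    -- lowers the total.
    obtain ⟨m, g, q, hq, e⟩ := ih (n + 2) (i.castSucc.insertNth (α := fun _ => FreeMagma X) u
      (Function.update f i v)) (comp i p (binaryOp F)) (hJ.comp_mem_left n 2 i p _ hp) (by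
        rw [Fin.sum_univ_succAbove _ i.castSucc]
        simp only [Fin.insertNth_apply_same, Fin.insertNth_apply_succAbove]
        have h1 : ∀ j, mulCount (Function.update f i v j) =
            Function.update (fun j => mulCount (f j)) i (mulCount v) j := fun j => by
          rcases eq_or_ne j i with rfl | h <;> simp [*]
        simp only [h1]
        rw [Finset.sum_update_of_mem (Finset.mem_univ i)]
        rw [← Finset.sum_erase_add _ _ (Finset.mem_univ i), hf,
          ← Finset.sdiff_singleton_eq_erase] at hN
        simp only [mulCount] at hN
        omega)
    refine ⟨m, g, q, hq, e ▸ ?_⟩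
    clear e hq hp hN
    induction p using Finsupp.induction_linear with
    | zero => simp
    | add p q hp hq => simp only [map_add, LinearMap.add_apply, hp, hq]
    | single w c =>
      rw [binaryOp, comp_single, substWords_single, substWords_single, Monomial.comp, lift_lift,
        mul_one]
      congr 3
      funext j
      have hins : ∀ (k : Fin (n + 2)) (j : Fin (n + 1)), k = i.castSucc.succAbove j →
          i.castSucc.insertNth (α := fun _ => FreeMagma X) u (Function.update f i v) k =
            Function.update f i v j := by
        rintro _ j rfl
        exact Fin.insertNth_apply_succAbove ..
      unfold substLetter
      rcases lt_trichotomy j i with h | rfl | h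
      · rw [dif_pos h, FreeMagma.lift_of, hins _ j, Function.update_of_ne h.ne]
        rw [Fin.succAbove_of_castSucc_lt _ _ (Fin.castSucc_lt_castSucc_iff.2 h)]
        rfl
      · rw [dif_neg (lt_irrefl j), dif_neg (lt_irrefl j), lift_map, map_mul, FreeMagma.lift_of,
          FreeMagma.lift_of, hf]
        refine (congrArg₂ FreeMagma.mul
          (Fin.insertNth_apply_same (α := fun _ => FreeMagma X) j.castSucc u _)
          ((hins _ j ?_).trans (Function.update_self ..))).symm
        rw [Fin.succAbove_castSucc_self]
        rfl
      · rw [dif_neg h.not_gt, dif_pos h, FreeMagma.lift_of, hins _ j, Function.update_of_ne h.ne']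
        rw [Fin.succAbove_of_lt_succ _ _ (Fin.castSucc_lt_succ_iff.2 h.le)]
        ext
        simp only [Fin.val_succ]
        have := Fin.lt_def.1 h
        omega

/-- By `exists_letter_subst` only substitutions of letters matter. A bijective one acts as a
permutation and preserves the ideal; any other repeats or omits a letter, so its multilinear part is
zero. -/
theorem multilinearPart_mem (hJ : IsOperadIdeal J) {n : ℕ} {z : FreeMagma (Fin n) →₀ F}
    (hz : z ∈ valueIdeal J (Fin n)) : multilinearPart F n z ∈ J n := by
  suffices valueIdeal J (Fin n) ≤ (J n).comap (multilinearPart F n) from this hz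
  refine Submodule.span_le.2 ?_
  rintro _ ⟨k, f, p, hp, rfl⟩
  obtain ⟨m, g, q, hq, e⟩ := exists_letter_subst hJ _ k f p hp rfl
  rw [e]
  change multilinearPart F n _ ∈ J n
  by_cases hg : Function.Bijective g
  · obtain rfl : m = n := by simpa using Fintype.card_of_bijective hg
    suffices multilinearPart F m (substWords (fun i => .of (g i)) q) =
        permRep F m (Equiv.ofBijective g hg) q by
      rw [this]
      exact hJ.perm_mem _ _ _ hq
    clear hq e
    induction q using Finsupp.induction_linear with
    | zero => simp
    | add p q hp hq => simp only [map_add, hp, hq]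
    | single w c =>
      rw [substWords_single, permRep_single]
      exact multilinearPart_single (w.relabel (Equiv.ofBijective g hg)) c
  · suffices multilinearPart F n (substWords (fun i => .of (g i)) q) = 0 by
      rw [this]
      exact zero_mem _
    clear hq e
    induction q using Finsupp.induction_linear with
    | zero => simp
    | add p q hp hq => simp only [map_add, hp, hq, add_zero]
    | single w c =>
      rw [substWords_single]
      refine multilinearPart_single_of_not (fun h => hg ?_) c
      change IsMultilinear (FreeMagma.map g w.1) at h
      have hw : letters w.1 = Finset.univ.val := w.2
      rw [isMultilinear_iff, letters_map, hw] at h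
      refine ⟨fun a b hab => Multiset.inj_on_of_nodup_map h.1 a (Finset.mem_univ_val a) b
        (Finset.mem_univ_val b) hab, fun b => ?_⟩
      obtain ⟨a, -, ha⟩ := Multiset.mem_map.1 (h.2 b)
      exact ⟨a, ha⟩

/-- The multilinear part of the relatively free algebra on `n` generators maps to the component
of arity `n` of the quotient operad. -/
def relMultilinearPart (hJ : IsOperadIdeal J) (n : ℕ) :
    ((FreeMagma (Fin n) →₀ F) ⧸ valueIdeal J (Fin n)) →ₗ[F] (FreeOperad F n ⧸ J n) :=
  (valueIdeal J (Fin n)).mapQ (J n) (multilinearPart F n) fun _ hz => multilinearPart_mem hJ hz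

theorem relMultilinearPart_evalWord (hJ : IsOperadIdeal J) {n : ℕ} (w : Monomial n) :
    relMultilinearPart hJ n (evalWord (relMul hJ (Fin n)) (relGen J) w.1) =
      (J n).mkQ (Finsupp.single w 1) := by
  rw [evalWord_relGen, ← multilinearPart_single]
  rfl

end RelativelyFree

/-! ### Right-normed monomials and regularity -/

theorem ofFn_castSucc_append_last {α : Type*} {k : ℕ} (f : Fin (k + 1) → α) :
    List.ofFn (fun i : Fin k => f i.castSucc) ++ [f (Fin.last k)] = List.ofFn f := by
  rw [List.ofFn_succ', List.concat_eq_append]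

/-- The right-normed multilinear monomial whose arguments are ordered by `σ`. -/
def combMon {k : ℕ} (σ : Equiv.Perm (Fin (k + 1))) : Monomial (k + 1) :=
  ⟨comb (List.ofFn fun i : Fin k => σ i.castSucc) (σ (Fin.last k)), by
    rw [isMultilinear_iff, letters_comb, ofFn_castSucc_append_last]
    exact ⟨List.nodup_ofFn.2 σ.injective, fun j => (List.mem_ofFn' _ _).2 (σ.surjective j)⟩⟩

theorem relabel_combMon {k : ℕ} (τ σ : Equiv.Perm (Fin (k + 1))) :
    (combMon σ).relabel τ = combMon (τ * σ) :=
  Subtype.ext <| by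
    simp only [Monomial.relabel, combMon, map_comb, List.map_ofFn]
    rfl

theorem exists_combMon_eq {k : ℕ} {l : List (Fin (k + 1))} {z : Fin (k + 1)}
    (h : ((l ++ [z] : List (Fin (k + 1))) : Multiset (Fin (k + 1))) = Finset.univ.val) :
    ∃ σ : Equiv.Perm (Fin (k + 1)), List.ofFn σ = l ++ [z] ∧ (combMon σ).1 = comb l z := by
  have hlen : (l ++ [z]).length = k + 1 := by
    simpa using congrArg Multiset.card h
  have hnd : (l ++ [z]).Nodup := by
    rw [← Multiset.coe_nodup, h]
    exact Finset.univ.nodup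
  let f : Fin (k + 1) → Fin (k + 1) := fun i => (l ++ [z]).get (i.cast hlen.symm)
  have hf : Function.Injective f := fun i j hij => by
    have := hnd.injective_get hij
    simpa [Fin.ext_iff] using this
  have e : List.ofFn f = l ++ [z] :=
    List.ext_get (by simpa using hlen.symm) fun m h₁ h₂ => by
      rw [List.get_ofFn]
      rfl
  refine ⟨Equiv.ofBijective f (Finite.injective_iff_bijective.1 hf), e, ?_⟩
  rw [← ofFn_castSucc_append_last] at e
  obtain ⟨e₁, e₂⟩ := List.append_inj' e rfl
  simp only [combMon, Equiv.ofBijective_apply, e₁, List.singleton_injective e₂]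

/-- The homomorphism from the regular module that sends `σ` to the class of the right-normed
monomial ordered by `σ`. -/
def combMap (ρ : FreeOperad F 3) (k : ℕ) :
    (Representation.leftRegular F (Equiv.Perm (Fin (k + 1)))).IntertwiningMap
      (quotientRep ρ (k + 1)) :=
  (Representation.leftRegularMapEquiv (quotientRep ρ (k + 1))).symm
    ((idealGen ρ (k + 1)).mkQ (Finsupp.single (combMon 1) 1))

theorem combMap_single (ρ : FreeOperad F 3) {k : ℕ} (σ : Equiv.Perm (Fin (k + 1))) :
    combMap ρ k (MonoidAlgebra.single σ 1) =
      (idealGen ρ (k + 1)).mkQ (Finsupp.single (combMon σ) 1) := by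
  rw [combMap, Representation.leftRegularMapEquiv_symm_single]
  change (idealGen ρ (k + 1)).mkQ (permRep F (k + 1) σ (Finsupp.single (combMon 1) 1)) = _
  rw [permRep_single, relabel_combMon, mul_one]

/-- Each monomial is straightened in the relatively free algebra. The straightening keeps the
multiset of letters, so only right-normed multilinear words occur, and these project to the images
of the basis of the regular module. -/
theorem combMap_surjective (x₁ x₂ x₃ x₄ : F) (k : ℕ) :
    Function.Surjective (combMap (lrRelation x₁ x₂ x₃ x₄ 0 0) k) := by
  set ρ := lrRelation x₁ x₂ x₃ x₄ 0 0 with hρ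
  have hJ := isOperadIdeal_idealGen ρ
  have hLR : SatisfiesLR (relMul hJ (Fin (k + 1))) x₁ x₂ x₃ x₄ :=
    relMul_satisfiesLR hJ (mem_idealGen.2 fun _ _ h => h) _
  suffices h : LinearMap.range (combMap ρ k).toLinearMap = ⊤ from LinearMap.range_eq_top.1 h
  refine Submodule.eq_top_iff'.2 fun y => ?_
  induction y using Submodule.Quotient.induction_on with | H y => ?_
  rw [← Submodule.mkQ_apply]
  induction y using Finsupp.induction_linear with
  | zero => simp
  | add p q hp hq => rw [map_add]; exact add_mem hp hq
  | single w c =>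
    rw [← mul_one c, ← smul_eq_mul, ← Finsupp.smul_single, map_smul]
    refine Submodule.smul_mem _ _ ?_
    rw [← relMultilinearPart_evalWord hJ]
    have hw := hLR.evalWord_mem_combSpan (relGen (idealGen ρ)) w.1
    have hle : combSpan (relMul hJ (Fin (k + 1))) (relGen (idealGen ρ)) (letters w.1) ≤
        (LinearMap.range (combMap ρ k).toLinearMap).comap (relMultilinearPart hJ (k + 1)) := by
      refine Submodule.span_le.2 ?_
      rintro _ ⟨l, z, hl, rfl⟩
      obtain ⟨σ, -, hσ⟩ := exists_combMon_eq (hl.trans w.2)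
      refine ⟨MonoidAlgebra.single σ 1, ?_⟩
      rw [← hσ, relMultilinearPart_evalWord]
      exact combMap_single ρ σ
    exact hle hw

/-- Regularity follows from the existence of a family of linear functionals on the quotient operad
dual to the right-normed monomials. -/
theorem isRegular_of_dual {x₁ x₂ x₃ x₄ : F}
    (h : ∀ (k : ℕ) (τ : Equiv.Perm (Fin (k + 1))), ∃ φ : FreeOperad F (k + 1) →ₗ[F] F,
      idealGen (lrRelation x₁ x₂ x₃ x₄ 0 0) (k + 1) ≤ LinearMap.ker φ ∧
      ∀ σ, φ (Finsupp.single (combMon σ) 1) = if σ = τ then 1 else 0) :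
    IsRegular (lrRelation x₁ x₂ x₃ x₄ 0 0) := by
  intro n hn
  obtain ⟨k, rfl⟩ : ∃ k, n = k + 1 := ⟨n - 1, by omega⟩
  set ρ := lrRelation x₁ x₂ x₃ x₄ 0 0 with hρ
  have hinj : Function.Injective (combMap ρ k).toLinearMap := by
    refine (injective_iff_map_eq_zero _).2 fun y hy => ?_
    ext τ
    obtain ⟨φ, hφ, hd⟩ := h k τ
    have key : ∀ y, (idealGen ρ (k + 1)).liftQ φ hφ ((combMap ρ k).toLinearMap y) = y.coeff τ := by
      intro y
      induction y using MonoidAlgebra.induction_linear with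
      | zero => simp
      | add p q hp hq => simp only [map_add, hp, hq]; rfl
      | single σ c =>
        have hs : MonoidAlgebra.single σ c = c • MonoidAlgebra.single σ (1 : F) := by simp
        rw [hs, map_smul, map_smul]
        have := combMap_single ρ σ
        change (combMap ρ k).toLinearMap (MonoidAlgebra.single σ 1) = _ at this
        rw [this, Submodule.mkQ_apply, Submodule.liftQ_apply, hd, ← hs]
        simp [Finsupp.single_apply]
    rw [← key, hy, map_zero]
    rfl
  exact ⟨(Representation.Equiv.mk (LinearEquiv.ofBijective (combMap ρ k).toLinearMap
    ⟨hinj, combMap_surjective x₁ x₂ x₃ x₄ k⟩) (combMap ρ k).isIntertwining').symm⟩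

/-- If the relation is regular, there are linear functionals on the relatively free algebra dual to
the right-normed monomials. -/
theorem IsRegular.exists_dual {x₁ x₂ x₃ x₄ : F} (h : IsRegular (lrRelation x₁ x₂ x₃ x₄ 0 0))
    {k : ℕ} {l₀ : List (Fin (k + 1))} {z₀ : Fin (k + 1)}
    (h₀ : ((l₀ ++ [z₀] : List (Fin (k + 1))) : Multiset (Fin (k + 1))) = Finset.univ.val) :
    ∃ φ : ((FreeMagma (Fin (k + 1)) →₀ F) ⧸
        valueIdeal (idealGen (lrRelation x₁ x₂ x₃ x₄ 0 0)) (Fin (k + 1))) →ₗ[F] F,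
      ∀ l z, ((l ++ [z] : List (Fin (k + 1))) : Multiset (Fin (k + 1))) = Finset.univ.val →
        φ (evalWord (relMul (isOperadIdeal_idealGen (lrRelation x₁ x₂ x₃ x₄ 0 0)) (Fin (k + 1)))
          (relGen (idealGen (lrRelation x₁ x₂ x₃ x₄ 0 0))) (comb l z)) =
          if l ++ [z] = l₀ ++ [z₀] then 1 else 0 := by
  set ρ := lrRelation x₁ x₂ x₃ x₄ 0 0 with hρ
  obtain ⟨e⟩ := h (k + 1) (by omega)
  have hsurj := combMap_surjective x₁ x₂ x₃ x₄ k
  have hinj : Function.Injective (combMap ρ k).toLinearMap := by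
    -- The composite is a surjective endomorphism of the finite-dimensional space `F Sₙ`, hence
    -- injective, whichever isomorphism `e` is given.
    have : Function.Injective (e.toLinearEquiv.toLinearMap ∘ₗ (combMap ρ k).toLinearMap) :=
      LinearMap.injective_iff_surjective.2 (e.toLinearEquiv.surjective.comp hsurj)
    exact Function.Injective.of_comp this
  let E := LinearEquiv.ofBijective (combMap ρ k).toLinearMap ⟨hinj, hsurj⟩
  obtain ⟨τ, hτ, -⟩ := exists_combMon_eq h₀
  refine ⟨Finsupp.lapply τ ∘ₗ (MonoidAlgebra.coeffLinearEquiv F).toLinearMap ∘ₗ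
    E.symm.toLinearMap ∘ₗ relMultilinearPart (isOperadIdeal_idealGen ρ) (k + 1),
    fun l z hl => ?_⟩
  obtain ⟨σ, hσl, hσ⟩ := exists_combMon_eq hl
  have hE : E.symm ((idealGen ρ (k + 1)).mkQ (Finsupp.single (combMon σ) 1)) =
      MonoidAlgebra.single σ 1 := by
    rw [LinearEquiv.symm_apply_eq]
    exact (combMap_single ρ σ).symm
  rw [← hσ]
  simp only [LinearMap.comp_apply, relMultilinearPart_evalWord, LinearEquiv.coe_coe, hE]
  have hiff : σ = τ ↔ l ++ [z] = l₀ ++ [z₀] := by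
    rw [← hσl, ← hτ, List.ofFn_inj, DFunLike.coe_fn_eq]
  simp [Finsupp.single_apply, hiff]

/-! ### Sufficiency: algebras in which the right-normed monomials are independent -/

theorem exists_dual_of_algebra {A : Type*} [AddCommGroup A] [Module F A]
    {μ : A →ₗ[F] A →ₗ[F] A} {x₁ x₂ x₃ x₄ : F} (h : SatisfiesLR μ x₁ x₂ x₃ x₄) {k : ℕ}
    (τ : Equiv.Perm (Fin (k + 1))) (f : Fin (k + 1) → A) (ψ : A →ₗ[F] F)
    (hψ : ∀ σ, ψ (evalWord μ f (combMon σ).1) = if σ = τ then 1 else 0) :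
    ∃ φ : FreeOperad F (k + 1) →ₗ[F] F,
      idealGen (lrRelation x₁ x₂ x₃ x₄ 0 0) (k + 1) ≤ LinearMap.ker φ ∧
      ∀ σ, φ (Finsupp.single (combMon σ) 1) = if σ = τ then 1 else 0 :=
  ⟨ψ ∘ₗ eval μ f, fun p hp => by
    rw [LinearMap.mem_ker, LinearMap.comp_apply, mem_identities.1 (h.idealGen_le _ hp), map_zero],
    fun σ => by rw [LinearMap.comp_apply, eval_single, one_smul, hψ]⟩

/-- The product `(x, m)(y, n) = (αxy + βyx, xn)` on two copies of an associative algebra. -/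
def hemiMul {E : Type*} [Ring E] [Algebra F E] (α β : F) :
    (E × E) →ₗ[F] (E × E) →ₗ[F] (E × E) :=
  LinearMap.mk₂ F (fun p q => (α • (p.1 * q.1) + β • (q.1 * p.1), p.1 * q.2))
    (fun p p' q => Prod.ext (by simp [add_mul, mul_add]; abel) (by simp [add_mul]))
    (fun c p q => Prod.ext (by simp [smul_comm c]) (by simp))
    (fun p q q' => Prod.ext (by simp [add_mul, mul_add]; abel) (by simp [mul_add]))
    (fun c p q => Prod.ext (by simp [smul_comm c]) (by simp))

theorem hemiMul_apply {E : Type*} [Ring E] [Algebra F E] (α β : F) (p q : E × E) :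
    hemiMul α β p q = (α • (p.1 * q.1) + β • (q.1 * p.1), p.1 * q.2) := rfl

/-- In the second component the relation holds for all `α`, `β` by associativity. The first
component requires it of the product `αxy + βyx`, which in the three cases is zero, associative, or
the commutator with its Jacobi identity. -/
theorem hemiMul_satisfiesLR {E : Type*} [Ring E] [Algebra F E] {α β : F}
    (h : (α = 0 ∧ β = 0) ∨ (α = 1 ∧ β = 0) ∨ (α = 1 ∧ β = -1)) :
    SatisfiesLR (hemiMul (E := E) α β) α 0 β 0 := by
  intro a b c
  rcases h with ⟨rfl, rfl⟩ | ⟨rfl, rfl⟩ | ⟨rfl, rfl⟩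
  · simp [hemiMul_apply]
  · simp [hemiMul_apply, mul_assoc]
  · simp only [hemiMul_apply, zero_smul, one_smul, neg_smul, add_zero, Prod.mk_add_mk, Prod.neg_mk]
    exact Prod.ext (by noncomm_ring) (by noncomm_ring)

/-- The second component of a right-normed word is the associative product of its letters, whatever
`α` and `β` are. In the free associative algebra distinct orderings give distinct basis elements. -/
theorem isRegular_of_hemiMul {α β : F}
    (h : (α = 0 ∧ β = 0) ∨ (α = 1 ∧ β = 0) ∨ (α = 1 ∧ β = -1)) :
    IsRegular (lrRelation α 0 β 0 0 0) := by
  classical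
  refine isRegular_of_dual fun k τ => ?_
  let E := MonoidAlgebra F (FreeMonoid (Fin (k + 1)))
  let x : Fin (k + 1) → E := fun i => MonoidAlgebra.single (FreeMonoid.of i) 1
  have hval : ∀ (l : List (Fin (k + 1))) z,
      (evalWord (hemiMul (F := F) α β) (fun i => (x i, x i)) (comb l z)).2 =
        MonoidAlgebra.single (FreeMonoid.ofList (l ++ [z])) 1 := by
    intro l z
    induction l with
    | nil => rfl
    | cons a l ih =>
      rw [comb_cons, evalWord_mul, hemiMul_apply, ih, evalWord_of, MonoidAlgebra.single_mul_single,
        mul_one]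
      rfl
  refine exists_dual_of_algebra (hemiMul_satisfiesLR (E := E) h) τ (fun i => (x i, x i))
    (Finsupp.lapply (FreeMonoid.ofList (List.ofFn τ)) ∘ₗ
      (MonoidAlgebra.coeffLinearEquiv F).toLinearMap ∘ₗ LinearMap.snd F E E) fun σ => ?_
  simp only [LinearMap.comp_apply, LinearMap.snd_apply, combMon, hval, ofFn_castSucc_append_last]
  have hiff : FreeMonoid.ofList (List.ofFn σ) = FreeMonoid.ofList (List.ofFn τ) ↔ σ = τ := by
    rw [FreeMonoid.ofList.apply_eq_iff_eq, List.ofFn_inj, DFunLike.coe_fn_eq]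
  change Finsupp.single (FreeMonoid.ofList (List.ofFn σ)) (1 : F) _ = _
  rw [Finsupp.single_apply]
  simp only [hiff]

/-! ### The Zinbiel point: products of finite sets compared by their maxima -/

section Zinbiel

variable {T : Type*} [LinearOrder T]

/-- `S` and `U` are disjoint, `U` is not empty, and some element of `S` exceeds all of `U`. -/
def Dominates (S U : Finset T) : Prop :=
  Disjoint S U ∧ U.Nonempty ∧ ∃ s ∈ S, ∀ u ∈ U, u < s

open Classical in
variable (F T) in
/-- The product on formal combinations of finite sets with `S U = S ∪ U` if `S` dominates `U` and
`S U = 0` otherwise. -/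
def setMul : (Finset T →₀ F) →ₗ[F] (Finset T →₀ F) →ₗ[F] (Finset T →₀ F) :=
  Finsupp.lsum F fun S => LinearMap.toSpanSingleton F _
    (Finsupp.lsum F fun U => LinearMap.toSpanSingleton F _
      (if Dominates S U then Finsupp.single (S ∪ U) 1 else 0))

open Classical in
theorem setMul_single (S U : Finset T) (c d : F) :
    setMul F T (Finsupp.single S c) (Finsupp.single U d) =
      if Dominates S U then Finsupp.single (S ∪ U) (c * d) else 0 := by
  simp only [setMul, Finsupp.lsum_single, LinearMap.toSpanSingleton_apply, LinearMap.smul_apply]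
  split_ifs <;> simp

/-- `S`, `U`, `V` are disjoint, `U` and `V` are not empty, and some element of `S` exceeds all of
`U` and `V`. -/
def DominatesBoth (S U V : Finset T) : Prop :=
  Disjoint S U ∧ Disjoint S V ∧ Disjoint U V ∧ U.Nonempty ∧ V.Nonempty ∧
    ∃ s ∈ S, (∀ u ∈ U, u < s) ∧ ∀ v ∈ V, v < s

theorem dominates_union_left (S U V : Finset T) :
    (Dominates S U ∧ Dominates (S ∪ U) V) ↔ DominatesBoth S U V := by
  simp only [Dominates, DominatesBoth, Finset.disjoint_union_left, Finset.mem_union]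
  constructor
  · rintro ⟨⟨h1, h2, s, hs, hsU⟩, ⟨h3, h4⟩, h5, t, ht | ht, htV⟩
    · rcases le_total s t with h | h
      · exact ⟨h1, h3, h4, h2, h5, t, ht, fun u hu => (hsU u hu).trans_le h, htV⟩
      · exact ⟨h1, h3, h4, h2, h5, s, hs, hsU, fun v hv => (htV v hv).trans_le h⟩
    · exact ⟨h1, h3, h4, h2, h5, s, hs, hsU, fun v hv => (htV v hv).trans (hsU t ht)⟩
  · rintro ⟨h1, h3, h4, h2, h5, s, hs, hU, hV⟩
    exact ⟨⟨h1, h2, s, hs, hU⟩, ⟨h3, h4⟩, h5, s, .inl hs, hV⟩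

theorem dominates_union_right (S U V : Finset T) :
    (Dominates U V ∧ Dominates S (U ∪ V)) ↔ DominatesBoth S U V ∧ Dominates U V := by
  simp only [Dominates, DominatesBoth, Finset.disjoint_union_right, Finset.mem_union]
  constructor
  · rintro ⟨⟨h1, h2, t, ht, htV⟩, ⟨h3, h4⟩, -, s, hs, h⟩
    exact ⟨⟨h3, h4, h1, ⟨t, ht⟩, h2, s, hs, fun u hu => h u (.inl hu), fun v hv => h v (.inr hv)⟩,
      h1, h2, t, ht, htV⟩
  · rintro ⟨⟨h3, h4, h1, hU, h2, s, hs, hsU, hsV⟩, h⟩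
    exact ⟨h, ⟨h3, h4⟩, hU.mono Finset.subset_union_left, s, hs,
      fun u hu => hu.elim (hsU u) (hsV u)⟩

/-- The larger of the two maxima decides, and disjointness makes the maxima different. Nonemptiness
is essential: of two empty sets neither dominates the other. -/
theorem DominatesBoth.dominates_iff {S U V : Finset T} (h : DominatesBoth S U V) :
    Dominates U V ↔ ¬ Dominates V U := by
  obtain ⟨-, -, hd, hU, hV, -⟩ := h
  constructor
  · rintro ⟨-, -, u, hu, huV⟩ ⟨-, -, v, hv, hvU⟩
    exact lt_asymm (huV v hv) (hvU u hu)
  · intro hn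
    rcases lt_or_ge (V.max' hV) (U.max' hU) with hlt | hle
    · exact ⟨hd, hV, _, U.max'_mem hU, fun v hv => (V.le_max' v hv).trans_lt hlt⟩
    · refine absurd ⟨hd.symm, hU, _, V.max'_mem hV, fun u hu =>
        lt_of_le_of_ne ((U.le_max' u hu).trans hle) fun e => ?_⟩ hn
      exact Finset.disjoint_left.1 hd hu (e ▸ V.max'_mem hV)

/-- `(SU)V` survives exactly when `S` dominates both `U` and `V`. In that case exactly one of
`S(UV)` and `S(VU)` survives, and with the same union. -/
theorem setMul_satisfiesLR : SatisfiesLR (setMul F T) 1 1 0 0 := by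
  classical
  intro a b c
  induction a using Finsupp.induction_linear with
  | zero => simp
  | add p q hp hq => simp only [map_add, LinearMap.add_apply, hp, hq, smul_add]; abel
  | single S r =>
  induction b using Finsupp.induction_linear with
  | zero => simp
  | add p q hp hq => simp only [map_add, LinearMap.add_apply, hp, hq, smul_add]; abel
  | single U s =>
  induction c using Finsupp.induction_linear with
  | zero => simp
  | add p q hp hq => simp only [map_add, LinearMap.add_apply, hp, hq, smul_add]; abel
  | single V t =>
    have h₁ : setMul F T (setMul F T (Finsupp.single S r) (Finsupp.single U s))
        (Finsupp.single V t) =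
        if DominatesBoth S U V then Finsupp.single (S ∪ U ∪ V) (r * s * t) else 0 := by
      rw [← dominates_union_left, setMul_single]
      by_cases hU : Dominates S U
      · simp only [hU, if_true, true_and, setMul_single]
      · simp only [hU, if_false, false_and, map_zero, LinearMap.zero_apply]
    have h₂ : ∀ (U V : Finset T) (s t : F),
        setMul F T (Finsupp.single S r)
          (setMul F T (Finsupp.single U s) (Finsupp.single V t)) =
        if DominatesBoth S U V ∧ Dominates U V then
          Finsupp.single (S ∪ (U ∪ V)) (r * (s * t)) else 0 := by
      intro U V s t
      simp only [← dominates_union_right]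
      rw [setMul_single]
      by_cases hU : Dominates U V
      · simp only [hU, if_true, true_and, setMul_single]
      · simp only [hU, if_false, false_and, map_zero]
    have hsymm : DominatesBoth S V U ↔ DominatesBoth S U V := by
      simp only [DominatesBoth, disjoint_comm (a := V)]
      tauto
    rw [h₁, h₂, h₂, hsymm, Finset.union_comm V U, mul_comm t s, Finset.union_assoc, mul_assoc]
    by_cases hb : DominatesBoth S U V
    · have := hb.dominates_iff
      by_cases hV : Dominates V U <;> simp [this, hb, hV]
    · simp [hb]

-- Each letter must exceed all the letters to its right, so a right-normed word in singletons
-- detects a single ordering of its letters.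
open Classical in
theorem evalWord_setMul_comb {X : Type*} (t : X → T) (l : List X) (z : X) :
    evalWord (setMul F T) (fun i => Finsupp.single {t i} 1) (comb l z) =
      if ((l ++ [z]).map t).Pairwise (· > ·) then
        Finsupp.single ((l ++ [z]).map t).toFinset 1 else 0 := by
  induction l with
  | nil => simp
  | cons a l ih =>
    rw [comb_cons, evalWord_mul, ih, evalWord_of, List.cons_append, List.map_cons]
    simp only [List.pairwise_cons]
    have hD : Dominates {t a} ((l ++ [z]).map t).toFinset ↔
        ∀ b ∈ (l ++ [z]).map t, t a > b := by
      simp only [Dominates, Finset.disjoint_singleton_left, List.mem_toFinset,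
        Finset.mem_singleton, exists_eq_left, List.toFinset_nonempty_iff]
      refine ⟨fun h => h.2.2, fun h => ⟨fun h' => lt_irrefl _ (h _ h'), by simp, h⟩⟩
    by_cases hP : ((l ++ [z]).map t).Pairwise (· > ·)
    · simp only [hP, if_true, setMul_single, hD, mul_one, and_true, List.toFinset_cons,
        Finset.insert_eq]
    · rw [if_neg hP, if_neg fun h => hP h.2, map_zero]

end Zinbiel

theorem perm_eq_of_strictMono {n : ℕ} {σ : Equiv.Perm (Fin n)} (h : StrictMono σ) : σ = 1 := by
  have := Subsingleton.elim (h.orderIsoOfSurjective σ σ.surjective) (OrderIso.refl (Fin n))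
  ext i
  exact congrArg Fin.val (DFunLike.congr_fun this i)

theorem isRegular_zinbiel : IsRegular (lrRelation (1 : F) 1 0 0 0 0) := by
  classical
  refine isRegular_of_dual fun k τ => ?_
  refine exists_dual_of_algebra (setMul_satisfiesLR (T := Fin (k + 1))) τ
    -- The labels `Fin.rev (τ⁻¹ i)` decrease along the ordering `τ` and along no other. The
    -- functional is the sum of coefficients; here the assignment, not the functional, depends on
    -- `τ`.
    (fun i => Finsupp.single {Fin.rev (τ⁻¹ i)} 1)
    (Finsupp.linearCombination F fun _ => (1 : F)) fun σ => ?_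
  have hiff : (List.ofFn fun i => Fin.rev (τ⁻¹ (σ i))).Pairwise (· > ·) ↔ σ = τ := by
    rw [List.pairwise_ofFn]
    constructor
    · intro h
      have h1 : StrictMono (τ⁻¹ * σ : Equiv.Perm (Fin (k + 1))) := fun i j hij =>
        Fin.rev_lt_rev.1 (h hij)
      exact (inv_mul_eq_one.1 (perm_eq_of_strictMono h1)).symm
    · rintro rfl i j hij
      simpa using hij
  rw [combMon, evalWord_setMul_comb (fun i => Fin.rev (τ⁻¹ i)), ofFn_castSucc_append_last,
    List.map_ofFn]
  change Finsupp.linearCombination F _ (if (List.ofFn fun i => Fin.rev (τ⁻¹ (σ i))).Pairwise (· > ·)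
    then _ else _) = _
  simp only [hiff]
  split_ifs <;> simp

/-! ### Necessity: the overlap `((ab)c)d` -/

/-- The difference of the two reductions of `((ab)c)d` to right-normed words. -/
theorem SatisfiesLR.overlap {A : Type*} [AddCommGroup A] [Module F A] {μ : A →ₗ[F] A →ₗ[F] A}
    {x₁ x₂ x₃ x₄ : F} (h : SatisfiesLR μ x₁ x₂ x₃ x₄) (a b c d : A) :
    (-(x₄ ^ 4) - 2 * x₂ * x₃ * x₄ ^ 2 - x₂ ^ 2 * x₃ ^ 2 - x₁ * x₂ * x₃ + x₁ ^ 2 - x₁ ^ 3) •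
      μ a (μ b (μ c d)) +
    (-(x₃ * x₄ ^ 3) - x₂ * x₃ ^ 2 * x₄ - x₁ * x₃ * x₄ ^ 2 + x₁ * x₂ - x₁ * x₂ * x₄ - x₁ * x₂ *
      x₃ ^ 2 - x₁ ^ 2 * x₂) •
      μ a (μ b (μ d c)) +
    (-(x₃ ^ 2 * x₄) + x₂ ^ 2 * x₄ - x₁ * x₃ ^ 2 + x₁ * x₂ ^ 2 - x₁ ^ 2 * x₃ - x₁ ^ 2 * x₂) •
      μ a (μ c (μ b d)) +
    (-(x₃ * x₄ ^ 2) + x₂ ^ 2 * x₃ - x₁ * x₃ * x₄ - x₁ * x₂ ^ 2 - x₁ ^ 2 * x₄ + x₁ ^ 2 * x₂) •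
      μ a (μ c (μ d b)) +
    (-(x₃ ^ 2 * x₄ ^ 2) - x₂ * x₃ ^ 3 + x₂ ^ 3 - x₁ * x₄ ^ 3 - x₁ * x₂ + x₁ * x₂ * x₄ - x₁ * x₂
      * x₃ * x₄) •
      μ a (μ d (μ b c)) +
    (-(x₃ * x₄ ^ 3) - x₂ * x₄ ^ 3 - x₂ * x₃ ^ 2 * x₄ - x₂ ^ 2 - x₂ ^ 2 * x₃ * x₄ + x₁ * x₂ * x₃
      + x₁ * x₂ ^ 2) •
      μ a (μ d (μ c b)) +
    (-(x₂ * x₄ ^ 3) - x₂ ^ 2 * x₃ * x₄ + x₁ * x₃ - x₁ * x₃ * x₄ - x₁ * x₂ * x₄ ^ 2 - x₁ * x₂ ^ 2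
      * x₃ - x₁ ^ 2 * x₃) •
      μ b (μ a (μ c d)) +
    (x₂ * x₃ - x₂ * x₃ * x₄ ^ 2 - x₁ * x₄ ^ 2 - x₁ * x₂ * x₃ - 2 * x₁ * x₂ * x₃ * x₄ - x₁ ^ 2 *
      x₂ * x₃) •
      μ b (μ a (μ d c)) +
    (x₂ * x₄ ^ 2 - x₂ * x₃ ^ 2 - x₁ * x₃ ^ 2 + x₁ * x₂ * x₄ - x₁ ^ 2 * x₄ - x₁ ^ 2 * x₃) •
      μ b (μ c (μ a d)) +
    (-(x₁ * x₃ * x₄) - x₁ * x₂ * x₄) •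
      μ b (μ c (μ d a)) +
    (-(x₂ * x₃) - x₂ * x₃ ^ 2 * x₄ + x₂ ^ 2 * x₄ + x₁ * x₄ ^ 2 - x₁ * x₂ * x₄ ^ 2 - x₁ * x₂ * x₃
      ^ 2 - x₁ ^ 2 * x₂ * x₄) •
      μ b (μ d (μ a c)) +
    (-(x₂ * x₄) - x₂ * x₃ * x₄ ^ 2 - x₂ ^ 2 * x₄ ^ 2 + x₁ * x₃ * x₄ + x₁ * x₂ * x₄ - x₁ * x₂ *
      x₃ * x₄ - x₁ * x₂ ^ 2 * x₄) •
      μ b (μ d (μ c a)) +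
    (-(x₃ ^ 3) - x₂ ^ 2 * x₄ ^ 2 - x₂ ^ 3 * x₃ - x₁ * x₄ ^ 3 + x₁ * x₃ - x₁ * x₃ * x₄ - x₁ * x₂
      * x₃ * x₄) •
      μ c (μ a (μ b d)) +
    (-(x₃ ^ 2 * x₄) + x₂ * x₃ - x₂ ^ 2 * x₃ * x₄ - x₁ * x₄ ^ 2 - x₁ * x₃ * x₄ ^ 2 - x₁ * x₂ ^ 2
      * x₃ - x₁ ^ 2 * x₃ * x₄) •
      μ c (μ a (μ d b)) +
    (-(x₃ * x₄ ^ 3) + x₃ ^ 2 - x₂ * x₄ ^ 3 - x₂ * x₃ ^ 2 * x₄ - x₂ ^ 2 * x₃ * x₄ - x₁ * x₃ ^ 2 -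
      x₁ * x₂ * x₃) •
      μ c (μ b (μ a d)) +
    (x₃ * x₄ - x₃ ^ 2 * x₄ ^ 2 - x₂ * x₃ * x₄ ^ 2 - x₁ * x₃ * x₄ - x₁ * x₃ ^ 2 * x₄ - x₁ * x₂ *
      x₄ - x₁ * x₂ * x₃ * x₄) •
      μ c (μ b (μ d a)) +
    (x₄ - x₃ ^ 2 * x₄ ^ 2 - 2 * x₂ * x₃ * x₄ ^ 2 - x₂ ^ 2 * x₄ ^ 2 - x₂ ^ 2 * x₃ ^ 2 - x₁ * x₃ ^
      2 * x₄ - x₁ * x₂ ^ 2 * x₄ - x₁ ^ 2 * x₄ ^ 2) •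
      μ c (μ d (μ a b)) +
    (-(x₃ ^ 3 * x₄) - x₂ * x₃ ^ 2 * x₄ - x₂ ^ 2 * x₃ * x₄ - x₂ ^ 3 * x₄ - 2 * x₁ * x₃ * x₄ ^ 2 -
      2 * x₁ * x₂ * x₄ ^ 2) •
      μ c (μ d (μ b a)) = 0 := by
  have h' : ∀ a b c, μ (μ a b) c =
    x₁ • μ a (μ b c) + x₂ • μ a (μ c b) + x₃ • μ b (μ a c) + x₄ • μ b (μ c a) := h
  -- The left side expands the outer product, treating `ab` as one element; the right side first
  -- expands the inner `(ab)c`.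
  have e := (h' (μ a b) c d).symm.trans (by rw [h' a b c])
  simp only [h', map_add, map_smul, LinearMap.add_apply, LinearMap.smul_apply] at e
  rw [← sub_eq_zero] at e
  rw [← e]
  module

/-- A selection of the overlap coefficients suffices. If `x₄ = 0`, then `hcdab` reads `(x₂x₃)² = 0`,
and each remaining case is solved by cancelling nonzero factors. If `x₄ ≠ 0`, both `x₁ = 0` and `x₁
≠ 0` force `x₃ = -x₂` and then `x₂ = 0`, which is contradictory. -/
theorem point_of_equations {x₁ x₂ x₃ x₄ : F}
    (habcd : -(x₄ ^ 4) - 2 * x₂ * x₃ * x₄ ^ 2 - x₂ ^ 2 * x₃ ^ 2 - x₁ * x₂ * x₃ + x₁ ^ 2 - x₁ ^ 3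
      = 0)
    (habdc : -(x₃ * x₄ ^ 3) - x₂ * x₃ ^ 2 * x₄ - x₁ * x₃ * x₄ ^ 2 + x₁ * x₂ - x₁ * x₂ * x₄ - x₁
      * x₂ * x₃ ^ 2 - x₁ ^ 2 * x₂ = 0)
    (hacdb : -(x₃ * x₄ ^ 2) + x₂ ^ 2 * x₃ - x₁ * x₃ * x₄ - x₁ * x₂ ^ 2 - x₁ ^ 2 * x₄ + x₁ ^ 2 *
      x₂ = 0)
    (hadbc : -(x₃ ^ 2 * x₄ ^ 2) - x₂ * x₃ ^ 3 + x₂ ^ 3 - x₁ * x₄ ^ 3 - x₁ * x₂ + x₁ * x₂ * x₄ -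
      x₁ * x₂ * x₃ * x₄ = 0)
    (hadcb : -(x₃ * x₄ ^ 3) - x₂ * x₄ ^ 3 - x₂ * x₃ ^ 2 * x₄ - x₂ ^ 2 - x₂ ^ 2 * x₃ * x₄ + x₁ *
      x₂ * x₃ + x₁ * x₂ ^ 2 = 0)
    (hbacd : -(x₂ * x₄ ^ 3) - x₂ ^ 2 * x₃ * x₄ + x₁ * x₃ - x₁ * x₃ * x₄ - x₁ * x₂ * x₄ ^ 2 - x₁
      * x₂ ^ 2 * x₃ - x₁ ^ 2 * x₃ = 0)
    (hbcad : x₂ * x₄ ^ 2 - x₂ * x₃ ^ 2 - x₁ * x₃ ^ 2 + x₁ * x₂ * x₄ - x₁ ^ 2 * x₄ - x₁ ^ 2 * x₃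
      = 0)
    (hbcda : -(x₁ * x₃ * x₄) - x₁ * x₂ * x₄ = 0)
    (hcabd : -(x₃ ^ 3) - x₂ ^ 2 * x₄ ^ 2 - x₂ ^ 3 * x₃ - x₁ * x₄ ^ 3 + x₁ * x₃ - x₁ * x₃ * x₄ -
      x₁ * x₂ * x₃ * x₄ = 0)
    (hcbad : -(x₃ * x₄ ^ 3) + x₃ ^ 2 - x₂ * x₄ ^ 3 - x₂ * x₃ ^ 2 * x₄ - x₂ ^ 2 * x₃ * x₄ - x₁ *
      x₃ ^ 2 - x₁ * x₂ * x₃ = 0)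
    (hcdab : x₄ - x₃ ^ 2 * x₄ ^ 2 - 2 * x₂ * x₃ * x₄ ^ 2 - x₂ ^ 2 * x₄ ^ 2 - x₂ ^ 2 * x₃ ^ 2 -
      x₁ * x₃ ^ 2 * x₄ - x₁ * x₂ ^ 2 * x₄ - x₁ ^ 2 * x₄ ^ 2 = 0) :
    (x₁, x₂, x₃, x₄) = (0, 0, 0, 0) ∨ (x₁, x₂, x₃, x₄) = (1, 0, 0, 0) ∨
      (x₁, x₂, x₃, x₄) = (1, 1, 0, 0) ∨ (x₁, x₂, x₃, x₄) = (1, 0, -1, 0) := by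
  by_cases h4 : x₄ = 0
  · subst h4
    have h23 : x₂ = 0 ∨ x₃ = 0 := by
      have : (x₂ * x₃) ^ 2 = 0 := by linear_combination -hcdab
      simpa using this
    by_cases h2 : x₂ = 0
    · subst h2
      by_cases h3 : x₃ = 0
      · subst h3
        have : x₁ ^ 2 * (1 - x₁) = 0 := by linear_combination habcd
        rcases mul_eq_zero.1 this with h | h
        · left
          simpa using h
        · right; left
          rw [sub_eq_zero.1 h]
      · have e1 : x₁ = x₃ ^ 2 := by
          refine mul_left_cancel₀ h3 ?_
          linear_combination hcabd
        have h1 : x₁ ≠ 0 := by rw [e1]; exact pow_ne_zero 2 h3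
        have e2 : x₁ = 1 := by
          refine mul_left_cancel₀ (mul_ne_zero h1 h3) ?_
          linear_combination -hbacd
        have e3 : x₃ = -1 := by
          subst e2
          refine mul_left_cancel₀ h3 ?_
          linear_combination -hbcad
        right; right; right
        rw [e2, e3]
    · have h3 : x₃ = 0 := h23.resolve_left h2
      subst h3
      have e1 : x₁ = x₂ ^ 2 := by
        refine mul_left_cancel₀ h2 ?_
        linear_combination -hadbc
      have h1 : x₁ ≠ 0 := by rw [e1]; exact pow_ne_zero 2 h2
      have e2 : x₁ = 1 := by
        refine mul_left_cancel₀ (mul_ne_zero h1 h2) ?_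
        linear_combination -habdc
      have e3 : x₂ = 1 := by
        subst e2
        refine mul_left_cancel₀ h2 ?_
        linear_combination -hacdb
      right; right; left
      rw [e2, e3]
  · exfalso
    by_cases h1 : x₁ = 0
    · subst h1
      have e1 : x₂ * x₃ = -x₄ ^ 2 := by
        -- With `x₁ = 0` the coefficient of `a(b(cd))` is minus a perfect square.
        have : (x₄ ^ 2 + x₂ * x₃) ^ 2 = 0 := by linear_combination -habcd
        linear_combination pow_eq_zero_iff two_ne_zero |>.1 this
      have h23 : x₂ * x₃ ≠ 0 := by rw [e1]; exact neg_ne_zero.2 (pow_ne_zero 2 h4)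
      have h2 : x₂ ≠ 0 := left_ne_zero_of_mul h23
      have h3 : x₃ ≠ 0 := right_ne_zero_of_mul h23
      have e2 : x₂ ^ 2 = x₄ ^ 2 := by
        refine mul_left_cancel₀ h3 ?_
        linear_combination hacdb
      have e3 : x₃ = -x₂ := by
        refine mul_left_cancel₀ h2 ?_
        linear_combination e1 + e2
      subst e3
      refine pow_ne_zero 2 h2 ?_
      linear_combination -hadcb
    · have e3 : x₃ = -x₂ := by
        refine mul_left_cancel₀ (mul_ne_zero h1 h4) ?_
        linear_combination -hbcda
      subst e3
      have h2 : x₂ = 0 := by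
        have : x₂ ^ 2 = 0 := by linear_combination hcbad
        simpa using this
      subst h2
      refine mul_ne_zero (pow_ne_zero 2 h1) h4 ?_
      linear_combination -hbcad

/-! ### Necessity: comparison of coefficients in arity four -/

theorem IsRegular.point_mem {x₁ x₂ x₃ x₄ : F} (h : IsRegular (lrRelation x₁ x₂ x₃ x₄ 0 0)) :
    (x₁, x₂, x₃, x₄) = (0, 0, 0, 0) ∨ (x₁, x₂, x₃, x₄) = (1, 0, 0, 0) ∨
      (x₁, x₂, x₃, x₄) = (1, 1, 0, 0) ∨ (x₁, x₂, x₃, x₄) = (1, 0, -1, 0) := by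
  have hJ := isOperadIdeal_idealGen (lrRelation x₁ x₂ x₃ x₄ 0 0)
  have hLR := relMul_satisfiesLR hJ (mem_idealGen.2 fun _ _ h => h) (Fin 4)
  let g : Fin 4 → _ := relGen (idealGen (lrRelation x₁ x₂ x₃ x₄ 0 0))
  have overlap := hLR.overlap (g 0) (g 1) (g 2) (g 3)
  have extract : ∀ i j k l : Fin 4, ([i, j, k, l] : Multiset (Fin 4)) = Finset.univ.val →
      ∃ φ : ((FreeMagma (Fin 4) →₀ F) ⧸
        valueIdeal (idealGen (lrRelation x₁ x₂ x₃ x₄ 0 0)) (Fin 4)) →ₗ[F] F,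
      ∀ i' j' k' l' : Fin 4, ([i', j', k', l'] : Multiset (Fin 4)) = Finset.univ.val →
        φ (relMul hJ (Fin 4) (g i') (relMul hJ (Fin 4) (g j') (relMul hJ (Fin 4) (g k') (g l')))) =
          if [i', j', k', l'] = [i, j, k, l] then 1 else 0 := by
    intro i j k l h₀
    obtain ⟨φ, hφ⟩ := h.exists_dual (l₀ := [i, j, k]) (z₀ := l) h₀
    exact ⟨φ, fun i' j' k' l' h' => hφ [i', j', k'] l' h'⟩
  choose φ hφ using extract
  have coeff := fun i j k l h₀ => congrArg (φ i j k l h₀) overlap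
  simp only [map_add, map_smul, map_zero, smul_eq_mul] at coeff
  -- The functional dual to a right-normed word picks out its coefficient in the overlap; the side
  -- goals say that each word uses all four letters once.
  simp (disch := decide) only [hφ] at coeff
  refine point_of_equations ?_ ?_ ?_ ?_ ?_ ?_ ?_ ?_ ?_ ?_ ?_
  · simpa using coeff 0 1 2 3 (by decide)
  · simpa using coeff 0 1 3 2 (by decide)
  · simpa using coeff 0 2 3 1 (by decide)
  · simpa using coeff 0 3 1 2 (by decide)
  · simpa using coeff 0 3 2 1 (by decide)
  · simpa using coeff 1 0 2 3 (by decide)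
  · simpa using coeff 1 2 0 3 (by decide)
  · simpa using coeff 1 2 3 0 (by decide)
  · simpa using coeff 2 0 1 3 (by decide)
  · simpa using coeff 2 1 0 3 (by decide)
  · simpa using coeff 2 3 0 1 (by decide)

end LROperad

end

theorem mainTheorem4 (F : Type*) [Field F] [CharZero F] :
    (∀ x₁ x₂ x₃ x₄ x₅ x₆ : F, x₅ = 0 → x₆ = 0 →
      (LROperad.IsRegular (LROperad.lrRelation x₁ x₂ x₃ x₄ x₅ x₆) ↔
        (x₁, x₂, x₃, x₄) = (0, 0, 0, 0) ∨ (x₁, x₂, x₃, x₄) = (1, 0, 0, 0) ∨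
          (x₁, x₂, x₃, x₄) = (1, 1, 0, 0) ∨ (x₁, x₂, x₃, x₄) = (1, 0, -1, 0))) ∧
    LROperad.lrRelation 0 0 0 0 0 0 = LROperad.leftNilpotentRelation F ∧
    LROperad.lrRelation 1 0 0 0 0 0 = LROperad.associativeRelation F ∧
    LROperad.lrRelation 1 1 0 0 0 0 = LROperad.zinbielRelation F ∧
    LROperad.lrRelation 1 0 (-1) 0 0 0 = LROperad.leibnizRelation F := by
  refine ⟨?_, ?_, ?_, ?_, ?_⟩
  · rintro x₁ x₂ x₃ x₄ _ _ rfl rfl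
    refine ⟨fun h => h.point_mem, ?_⟩
    rintro (h | h | h | h) <;> obtain ⟨rfl, rfl, rfl, rfl⟩ := by simpa only [Prod.mk.injEq] using h
    · exact LROperad.isRegular_of_hemiMul (.inl ⟨rfl, rfl⟩)
    · exact LROperad.isRegular_of_hemiMul (.inr (.inl ⟨rfl, rfl⟩))
    · exact LROperad.isRegular_zinbiel
    · exact LROperad.isRegular_of_hemiMul (.inr (.inr ⟨rfl, rfl⟩))
  · simp [LROperad.lrRelation, LROperad.leftNilpotentRelation]
  · simp [LROperad.lrRelation, LROperad.associativeRelation]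
  · simp [LROperad.lrRelation, LROperad.zinbielRelation]
  · simp [LROperad.lrRelation, LROperad.leibnizRelation, sub_eq_add_neg]
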